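/- \textbf{Model.} Let $n\ge 1$, $p$, $K$, $N\ge 2$ be integers. Let $A\in\mathbb R^{p\times K}$ and $W\in\mathbb R^{K\times n}$ have non-negative entries and columns summing to $1$, and put $\Pi=AW$. We observe independent vectors $Y_1,\dots,Y_n$ with $Y_i\sim\mathrm{Multinomial}_p(N,\Pi_{\cdot i})$; let $X\in\mathbb R^{p\times n}$ have columns $X_i=Y_i/N$. Write $M=\max(n,p,N)$, $[p]=\{1,\dots,p\}$, and, for a matrix $Q$, $D_Q=\mathrm{diag}(\|Q_{1\cdot}\|_1,\|Q_{2\cdot}\|_1,\dots)$. \textbf{Population quantities.} $I_k=\{j: A_{jk}>0,\ A_{j\ell}=0\ \forall \ell\neq k\}$ is the set of anchor words of topic $k$, and $I=\bigcup_k I_k$. Let $\widetilde W=D_W^{-1}W$, $\widetilde A=D_\Pi^{-1}AD_W$, $\widetilde C=n\widetilde W\widetilde W^T$, $\Theta=\frac1n\Pi\Pi^T$, $m_j=p\max_i\Pi_{ji}$, $\mu_j=\frac pn\sum_i\Pi_{ji}$, and $$\nu=\min_{1\le a<b\le K}\bigl(\min(\widetilde C_{aa},\widetilde C_{bb})-\widetilde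 C_{ab}\bigr)\qquad(\nu=+\infty\text{ if }K=1).$$ With $\kappa_1=\sqrt{6/n}$, $\kappa_2=4/M^3$, $\kappa_3=2(1+\kappa_1)/(1-\kappa_1-\kappa_1^2)^2$, let $$\eta_{j\ell}=3\sqrt6\Bigl(\sqrt{\tfrac{m_j}p}+\sqrt{\tfrac{m_\ell}p}\Bigr)\sqrt{\tfrac{\Theta_{j\ell}\log M}{nN}}+\tfrac{2(m_j+m_\ell)}{p}\tfrac{\log M}{nN}+31(1+\kappa_1)\sqrt{\tfrac{\mu_j+\mu_\ell}{p}\tfrac{(\log M)^4}{nN^3}}+\kappa_2,$$ $$\delta_{j\ell}=(1+\kappa_1\kappa_3)\tfrac{p^2}{\mu_j\mu_\ell}\eta_{j\ell}+\kappa_3\tfrac{p^2\Theta_{j\ell}}{\mu_j\mu_\ell}\Bigl(\sqrt{\tfrac p{\mu_j}}+\sqrt{\tfrac p{\mu_\ell}}\Bigr)\sqrt{\tfrac{\log M}{nN}},\qquad \delta=\max_{j,\ell}\delta_{j\ell}.$$ The set of quasi-anchor words is $J_1=\{j\in[p]\setminus I:\ \exists k,\ \widetilde A_{jk}\ge 1-4\delta/\nu\}$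 (with $4\delta/\nu=0$ if $\nu=+\infty$). \textbf{Algorithm.} Let $$\widehat\Theta=\frac1n\sum_{i=1}^n\Bigl[\tfrac N{N-1}X_iX_i^T-\tfrac1{N-1}\mathrm{diag}(X_i)\Bigr],\qquad \widehat R=(nD_X^{-1})\widehat\Theta(nD_X^{-1}).$$ For each $i\in[p]$ let $\widehat a_i\in\arg\max_j\widehat R_{ij}$ (ties broken arbitrarily) and $\widehat I^{(i)}=\{\ell:\widehat R_{i\widehat a_i}-\widehat R_{i\ell}\le\delta_{i\widehat a_i}+\delta_{i\ell}\}$. Start with the empty list of groups. For $i=1,\dots,p$: if $|\widehat R_{ij}-\widehat R_{j\widehat a_j}|\le\delta_{ij}+\delta_{j\widehat a_j}$ for all $j\in\widehat I^{(i)}$, then replace the first group $G$ of the list that meets $\widehat I^{(i)}$ by $G\cap\widehat I^{(i)}$, or, if no group meets it, add $\widehat I^{(i)}$ as a new group; otherwise leave the list unchanged. The output is the final list $\widehat I_1,\dots,\widehat I_{\widehat K}$; put $\widehat I=\bigcup_k\widehat I_k$. \textbf{Statement.} Assume that $I_k\neq\emptyset$ for every $k$, that $\nu>4\delta$, that $J_1=\emptyset$,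 and that $$\min_{1\le j\le p}\frac1n\sum_{i=1}^n\Pi_{ji}\ge\frac{2\log M}{3N},\qquad \min_{1\le j\le p}\max_{1\le i\le n}\Pi_{ji}\ge\frac{(3\log M)^2}N.$$ Then, with probability greater than $1-8M^{-1}$, the following holds for every way of breaking ties: $\widehat K=K$, $\widehat I=I$, and there is a permutation $\pi$ of $\{1,\dots,K\}$ with $\widehat I_k=I_{\pi(k)}$ for all $1\le k\le K$. -/

import Mathlib

open MeasureTheory ProbabilityTheory

noncomputable section

namespace TopicModel

variable {p n K : ℕ}

/-- Entrywise non-negative matrices all of whose columns sum to one. -/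
def ColumnsAreProbabilities {a b : ℕ} (B : Matrix (Fin a) (Fin b) ℝ) : Prop :=
  (∀ i j, 0 ≤ B i j) ∧ ∀ j, ∑ i, B i j = 1

/-- The probability of the count vector `y` under the multinomial distribution
with `N` trials and cell probabilities `q`. -/
def multinomialProb (N : ℕ) (q : Fin p → ℝ) (y : Fin p → ℕ) : ℝ :=
  if ∑ j, y j = N then (Nat.multinomial Finset.univ y : ℝ) * ∏ j, q j ^ y j else 0

/-- `Y 0, …, Y (n-1)` are independent, and `Y i` is multinomial with `N` trials and cell
probabilities given by the `i`-th column of `Pm`. -/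
structure IsMultinomialSample {Ω : Type*} [MeasurableSpace Ω] (P : Measure Ω) (N : ℕ)
    (Pm : Matrix (Fin p) (Fin n) ℝ) (Y : Fin n → Ω → (Fin p → ℕ)) : Prop where
  measurable : ∀ i, Measurable (Y i)
  indep : iIndepFun Y P
  law : ∀ i y, P.real {ω | Y i ω = y} = multinomialProb N (fun j => Pm j i) y

/-! ### Population quantities -/

open Classical in
/-- The anchor words of topic `k`. -/
def anchorWords (A : Matrix (Fin p) (Fin K) ℝ) (k : Fin K) : Finset (Fin p) :=
  Finset.univ.filter fun j => 0 < A j k ∧ ∀ l, l ≠ k → A j l = 0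

/-- The set of all anchor words. -/
def anchorSet (A : Matrix (Fin p) (Fin K) ℝ) : Finset (Fin p) :=
  Finset.univ.biUnion (anchorWords A)

/-- The `ℓ₁` norm of row `i` of a matrix. -/
def rowNorm {a b : ℕ} (B : Matrix (Fin a) (Fin b) ℝ) (i : Fin a) : ℝ := ∑ j, |B i j|

/-- The row-normalised matrix `D_W⁻¹ W`. -/
def Wtilde (W : Matrix (Fin K) (Fin n) ℝ) : Matrix (Fin K) (Fin n) ℝ :=
  Matrix.diagonal (fun k => (rowNorm W k)⁻¹) * W

/-- The matrix `n W̃ W̃ᵀ`. -/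
def Ctilde (W : Matrix (Fin K) (Fin n) ℝ) : Matrix (Fin K) (Fin K) ℝ :=
  (n : ℝ) • (Wtilde W * (Wtilde W).transpose)

/-- The matrix `D_Π⁻¹ A D_W`, where `Π = A W`. -/
def Atilde (A : Matrix (Fin p) (Fin K) ℝ) (W : Matrix (Fin K) (Fin n) ℝ) :
    Matrix (Fin p) (Fin K) ℝ :=
  Matrix.diagonal (fun j => (rowNorm (A * W) j)⁻¹) * A * Matrix.diagonal (rowNorm W)

/-- The separation `min_{a < b} (min (C̃ a a) (C̃ b b) - C̃ a b)` between topics. It is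
extended-real valued so that the minimum over no pair (a single topic) is `+∞`. -/
def nu (W : Matrix (Fin K) (Fin n) ℝ) : EReal :=
  ⨅ (a : Fin K) (b : Fin K) (_ : a < b),
    ((min (Ctilde W a a) (Ctilde W b b) - Ctilde W a b : ℝ) : EReal)

/-- `M = max (n, p, N)`. -/
def bigM (n p N : ℕ) : ℕ := max (max n p) N

/-- `m_j = p · max_i Π_{ji}`. -/
def mMax (Pm : Matrix (Fin p) (Fin n) ℝ) (j : Fin p) : ℝ := (p : ℝ) * ⨆ i, Pm j i

/-- `μ_j = (p / n) ∑_i Π_{ji}`. -/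
def mu (Pm : Matrix (Fin p) (Fin n) ℝ) (j : Fin p) : ℝ := (p : ℝ) / n * ∑ i, Pm j i

/-- `Θ = n⁻¹ Π Πᵀ`. -/
def Theta (Pm : Matrix (Fin p) (Fin n) ℝ) : Matrix (Fin p) (Fin p) ℝ :=
  (n : ℝ)⁻¹ • (Pm * Pm.transpose)

def kappa₁ (n : ℕ) : ℝ := √(6 / n)

def kappa₂ (n p N : ℕ) : ℝ := 4 / (bigM n p N : ℝ) ^ 3

def kappa₃ (n : ℕ) : ℝ := 2 * (1 + kappa₁ n) / (1 - kappa₁ n - kappa₁ n ^ 2) ^ 2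

/-- The entrywise error level `η_{jl}` for the estimation of `Θ`. -/
def eta (N : ℕ) (Pm : Matrix (Fin p) (Fin n) ℝ) (j l : Fin p) : ℝ :=
  3 * √6 * (√(mMax Pm j / p) + √(mMax Pm l / p))
      * √(Theta Pm j l * Real.log (bigM n p N) / (n * N))
    + 2 * (mMax Pm j + mMax Pm l) / p * (Real.log (bigM n p N) / (n * N))
    + 31 * (1 + kappa₁ n)
      * √((mu Pm j + mu Pm l) / p * (Real.log (bigM n p N) ^ 4 / (n * (N : ℝ) ^ 3)))
    + kappa₂ n p N

/-- The entrywise error level `δ_{jl}` for the estimation of `R = (n D_Π⁻¹) Θ (n D_Π⁻¹)`. -/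
def deltaEntry (N : ℕ) (Pm : Matrix (Fin p) (Fin n) ℝ) (j l : Fin p) : ℝ :=
  (1 + kappa₁ n * kappa₃ n) * ((p : ℝ) ^ 2 / (mu Pm j * mu Pm l)) * eta N Pm j l
    + kappa₃ n * ((p : ℝ) ^ 2 * Theta Pm j l / (mu Pm j * mu Pm l))
      * (√(p / mu Pm j) + √(p / mu Pm l)) * √(Real.log (bigM n p N) / (n * N))

/-- `δ = max_{j,l} δ_{jl}`. -/
def delta (N : ℕ) (Pm : Matrix (Fin p) (Fin n) ℝ) : ℝ :=
  ⨆ q : Fin p × Fin p, deltaEntry N Pm q.1 q.2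

/-- The quasi-anchor words: the non-anchor words `j` with `Ã_{jk} ≥ 1 - 4 δ / ν` for some topic
`k` (where `4 δ / ν = 0` if `ν = +∞`). -/
def quasiAnchor (N : ℕ) (A : Matrix (Fin p) (Fin K) ℝ) (W : Matrix (Fin K) (Fin n) ℝ) :
    Set (Fin p) :=
  {j | j ∉ anchorSet A ∧
    ∃ k, (1 : EReal) - ((4 * delta N (A * W) : ℝ) : EReal) / nu W ≤ ((Atilde A W j k : ℝ) : EReal)}

/-! ### Estimators -/

/-- The observed word frequencies `X_{ji} = Y_{ji} / N`. -/
def freq {Ω : Type*} (N : ℕ) (Y : Fin n → Ω → (Fin p → ℕ)) (ω : Ω) :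
    Matrix (Fin p) (Fin n) ℝ :=
  Matrix.of fun j i => (Y i ω j : ℝ) / N

/-- `Θ̂ = n⁻¹ ∑_i [N / (N - 1) X_i X_iᵀ - (N - 1)⁻¹ diag X_i]`. -/
def ThetaHat (N : ℕ) (X : Matrix (Fin p) (Fin n) ℝ) : Matrix (Fin p) (Fin p) ℝ :=
  (n : ℝ)⁻¹ • ∑ i : Fin n,
    (((N : ℝ) / ((N : ℝ) - 1)) • Matrix.vecMulVec (fun j => X j i) (fun j => X j i)
      - ((N : ℝ) - 1)⁻¹ • Matrix.diagonal (fun j => X j i))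

/-- `R̂ = (n D_X⁻¹) Θ̂ (n D_X⁻¹)`. -/
def RHat (N : ℕ) (X : Matrix (Fin p) (Fin n) ℝ) : Matrix (Fin p) (Fin p) ℝ :=
  Matrix.diagonal (fun j => (n : ℝ) * (rowNorm X j)⁻¹) * ThetaHat N X
    * Matrix.diagonal (fun j => (n : ℝ) * (rowNorm X j)⁻¹)

/-! ### The algorithm -/

/-- `a` picks, for every row of `R`, a column at which the row is maximal (ties are broken in
any way). -/
def IsArgmax (R : Matrix (Fin p) (Fin p) ℝ) (a : Fin p → Fin p) : Prop :=
  ∀ i j, R i j ≤ R i (a i)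

/-- The candidate group of word `i`. -/
def candidate (R Q : Matrix (Fin p) (Fin p) ℝ) (a : Fin p → Fin p) (i : Fin p) :
    Finset (Fin p) :=
  Finset.univ.filter fun l => R i (a i) - R i l ≤ Q i (a i) + Q i l

/-- The test by which the algorithm declares word `i` an anchor word. -/
def PassesTest (R Q : Matrix (Fin p) (Fin p) ℝ) (a : Fin p → Fin p) (i : Fin p) : Prop :=
  ∀ j ∈ candidate R Q a i, |R i j - R j (a j)| ≤ Q i j + Q j (a j)

/-- Merge `S` into a list of groups: the first group that meets `S` is replaced by its
intersection with `S`; if there is none, `S` is added as a new group. -/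
def merge (S : Finset (Fin p)) : List (Finset (Fin p)) → List (Finset (Fin p))
  | [] => [S]
  | G :: Gs => if (G ∩ S).Nonempty then (G ∩ S) :: Gs else G :: merge S Gs

open Classical in
/-- The list of estimated groups of anchor words, computed from `R` with tolerances `Q`. -/
def findAnchorWords (R Q : Matrix (Fin p) (Fin p) ℝ) (a : Fin p → Fin p) :
    List (Finset (Fin p)) :=
  (List.finRange p).foldl
    (fun Gs i => if PassesTest R Q a i then merge (candidate R Q a i) Gs else Gs) []

/-- The union of the groups in a list. -/
def unionOf (Gs : List (Finset (Fin p))) : Finset (Fin p) :=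
  Gs.foldr (fun G S => G ∪ S) ∅

/-- The groups `Gs` recover the number of topics, the set of anchor words, and the partition of
the anchor words up to a permutation of the labels. -/
def ExactRecovery (A : Matrix (Fin p) (Fin K) ℝ) (Gs : List (Finset (Fin p))) : Prop :=
  ∃ hK : Gs.length = K,
    unionOf Gs = anchorSet A ∧
      ∃ π : Equiv.Perm (Fin K), ∀ k : Fin K, Gs.get (Fin.cast hK.symm k) = anchorWords A (π k)

end TopicModel

end

open TopicModel

namespace TopicModel

/-! ### The algorithm on a matrix entrywise close to a factorised one. -/

variable {p n K : ℕ}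

/-! The randomness enters only through one event, of probability above `1 - 8 / M`, on which every
entry of `R̂` is within `δ_{jl}` of `R = Ã C̃ Ãᵀ`. On that event the algorithm is analysed
deterministically.

Deterministic half (`exactRecovery_of_entrywise_close`). The rows of `Ã` are probability vectors
over topics, and unit vectors at anchor words. For an anchor word `i` of topic `k`, `R_{il}` is the
average of row `k` of `C̃` with weights `Ã_{l·}`. Since `C̃_{kk}` beats the rest of its row by at
least `ν`, `R_{il} ≤ C̃_{kk} - (1 - Ã_{lk}) ν`, while `R_{il} = C̃_{kk}` for `l ∈ I_k`. Without
quasi-anchor words the gap exceeds `4δ`, the most that four tolerances can hide, so the candidate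
group of `i` is `I_k`. For a non-anchor word `i`, row `i` of `R` attains its maximum at an anchor
word `j` of some topic. This `j` is a candidate, but `R_{ij}` lies more than `4δ` below `R_{jj}`, so
the test fails.

Probabilistic half. With `r_j` the relative error of the `j`-th row mean, `ThetaHat_eq` splits
`Θ̂_{jl}` into `Θ_{jl} (1 + r_j + r_l)`, a linear part and a degenerate part. The linear
coefficients are centred so that normalising by the row means leaves only (linear + degenerate -
`Θ_{jl} r_j r_l`), divided by the empirical row means. The linear part and the `r_j` are linear in
the counts and obey Bernstein's inequality (`bernstein_freq`). The degenerate part has mean zero and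
is of the size of a product of two deviations; truncated to the Bernstein range, it is summed over
documents by Hoeffding's inequality (`tail_truncRemainder`). The signal conditions force `log M ≥
11/2` and `N ≥ 200` (`StrongSignal.of_assumptions`) and let every lower-order term be absorbed into
`η`; `GoodEvent.abs_RHat_sub_le` collects the constants. -/

theorem mem_anchorWords {A : Matrix (Fin p) (Fin K) ℝ} {k : Fin K} {j : Fin p} :
    j ∈ anchorWords A k ↔ 0 < A j k ∧ ∀ l, l ≠ k → A j l = 0 := by
  simp [anchorWords]

theorem mem_anchorSet {A : Matrix (Fin p) (Fin K) ℝ} {j : Fin p} :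
    j ∈ anchorSet A ↔ ∃ k, j ∈ anchorWords A k := by
  simp [anchorSet]

theorem anchorWords_inter {A : Matrix (Fin p) (Fin K) ℝ} {k l : Fin K} (h : k ≠ l) :
    anchorWords A k ∩ anchorWords A l = ∅ := by
  ext j
  simp only [Finset.mem_inter, mem_anchorWords, Finset.notMem_empty, iff_false]
  rintro ⟨⟨_, h2⟩, h3, _⟩
  rw [h2 l h.symm] at h3
  exact lt_irrefl _ h3

theorem eq_of_mem_anchorWords {A : Matrix (Fin p) (Fin K) ℝ} {k l : Fin K} {j : Fin p}
    (hk : j ∈ anchorWords A k) (hl : j ∈ anchorWords A l) : k = l := by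
  by_contra h
  have := anchorWords_inter (A := A) h
  exact Finset.notMem_empty j (this ▸ Finset.mem_inter.2 ⟨hk, hl⟩)

/-- Anchor classes are non-empty and pairwise disjoint, so the only listed group that can meet the
class of `k` is that class itself, and intersecting changes nothing. -/
theorem merge_map_anchorWords {A : Matrix (Fin p) (Fin K) ℝ}
    (hsep : ∀ k, (anchorWords A k).Nonempty) (k : Fin K) (ks : List (Fin K)) :
    merge (anchorWords A k) (ks.map (anchorWords A))
      = (if k ∈ ks then ks else ks ++ [k]).map (anchorWords A) := by
  induction ks with
  | nil => simp [merge]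
  | cons l ls ih =>
    by_cases h : l = k
    · subst h
      simp [merge, hsep]
    · have h' : ¬ k = l := fun e => h e.symm
      rw [List.map_cons, merge, anchorWords_inter h, if_neg (by simp), ih]
      by_cases hk : k ∈ ls <;> simp [hk, h']

theorem unionOf_map {α : Type*} (f : α → Finset (Fin p)) (ks : List α) (j : Fin p) :
    j ∈ unionOf (ks.map f) ↔ ∃ k ∈ ks, j ∈ f k := by
  induction ks with
  | nil => simp [unionOf]
  | cons l ls ih =>
    have : unionOf ((l :: ls).map f) = f l ∪ unionOf (ls.map f) := rfl
    rw [this, Finset.mem_union, ih]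
    simp

/-- If the words passing the test are exactly the anchor words, and the candidate group of an
anchor word consists of the anchor words of its topic, the algorithm recovers the partition. -/
theorem exactRecovery_of_candidate_eq {A : Matrix (Fin p) (Fin K) ℝ}
    {R Q : Matrix (Fin p) (Fin p) ℝ} {a : Fin p → Fin p}
    (hsep : ∀ k, (anchorWords A k).Nonempty)
    (hcand : ∀ k, ∀ i ∈ anchorWords A k, PassesTest R Q a i ∧ candidate R Q a i = anchorWords A k)
    (hfail : ∀ i, i ∉ anchorSet A → ¬ PassesTest R Q a i) :
    ExactRecovery A (findAnchorWords R Q a) := by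
  classical
  -- Loop invariant: the list of groups is always the image of a duplicate-free list of topics,
  -- namely those already met through one of their anchor words.
  have key : ∀ is : List (Fin p), ∀ ks : List (Fin K), ks.Nodup →
      ∃ ks' : List (Fin K), ks'.Nodup ∧
        (∀ k, k ∈ ks' ↔ k ∈ ks ∨ ∃ i ∈ is, i ∈ anchorWords A k) ∧
        is.foldl (fun Gs i => if PassesTest R Q a i then merge (candidate R Q a i) Gs else Gs)
          (ks.map (anchorWords A)) = ks'.map (anchorWords A) := by
    intro is
    induction is with
    | nil => intro ks h; exact ⟨ks, h, by simp, rfl⟩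
    | cons i is ih =>
      intro ks h
      by_cases hi : i ∈ anchorSet A
      · obtain ⟨k, hk⟩ := mem_anchorSet.1 hi
        obtain ⟨hp, hc⟩ := hcand k i hk
        have hks : (if k ∈ ks then ks else ks ++ [k]).Nodup := by
          split_ifs with hm
          · exact h
          · exact List.nodup_append.2 ⟨h, by simp, by
              intro x hx y hy; simp at hy; subst hy; exact fun e => hm (e ▸ hx)⟩
        obtain ⟨ks', h1, h2, h3⟩ := ih _ hks
        refine ⟨ks', h1, fun l => ?_, ?_⟩
        · rw [h2 l]
          have : (∃ i' ∈ i :: is, i' ∈ anchorWords A l) ↔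
              l = k ∨ ∃ i' ∈ is, i' ∈ anchorWords A l := by
            simp only [List.mem_cons, exists_eq_or_imp]
            refine or_congr ⟨fun e => eq_of_mem_anchorWords e hk, fun e => e ▸ hk⟩ Iff.rfl
          rw [this]
          by_cases hm : k ∈ ks
          · simp only [hm, if_true]
            constructor
            · tauto
            · rintro (h | rfl | h) <;> tauto
          · simp [hm, or_assoc]
        · rw [List.foldl_cons, if_pos hp, hc, merge_map_anchorWords hsep, h3]
      · obtain ⟨ks', h1, h2, h3⟩ := ih ks h
        refine ⟨ks', h1, fun l => ?_, ?_⟩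
        · rw [h2 l]
          have : i ∉ anchorWords A l := fun e => hi (mem_anchorSet.2 ⟨l, e⟩)
          simp [this]
        · rw [List.foldl_cons, if_neg (hfail i hi), h3]
  obtain ⟨ks, hnd, hmem, hks⟩ := key (List.finRange p) [] List.nodup_nil
  have hall : ∀ k, k ∈ ks := fun k => (hmem k).2 (Or.inr (by
    obtain ⟨j, hj⟩ := hsep k
    exact ⟨j, by simp, hj⟩))
  have hfind : findAnchorWords R Q a = ks.map (anchorWords A) := by
    rw [← hks]; simp only [findAnchorWords, List.map_nil]
  have hlen : ks.length = K := by
    have h := List.toFinset_card_of_nodup hnd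
    have : ks.toFinset = Finset.univ := by ext k; simp [hall k]
    rw [this, Finset.card_univ, Fintype.card_fin] at h
    exact h.symm
  refine ⟨by rw [hfind, List.length_map, hlen], ?_, ?_⟩
  · ext j
    rw [hfind, unionOf_map, mem_anchorSet]
    simp [hall]
  · have hinj : Function.Injective fun k : Fin K => ks.get (Fin.cast hlen.symm k) := by
      intro x y hxy
      have := (List.nodup_iff_injective_get.1 hnd) hxy
      simpa [Fin.ext_iff] using this
    refine ⟨Equiv.ofBijective _ (Finite.injective_iff_bijective.1 hinj), fun k => ?_⟩
    simp [hfind]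

/-- Each comparison made by the algorithm involves four tolerances of at most `d`, so a gap above `4
* d` in `T C Tᵀ` survives the noise, while exact ties always stay within the tolerances. -/
theorem exactRecovery_of_entrywise_close {A T : Matrix (Fin p) (Fin K) ℝ}
    {C : Matrix (Fin K) (Fin K) ℝ} {R Q : Matrix (Fin p) (Fin p) ℝ} {a : Fin p → Fin p} {d v : ℝ}
    (hT0 : ∀ j k, 0 ≤ T j k) (hT1 : ∀ j, ∑ k, T j k = 1)
    (hanchor : ∀ k, ∀ j ∈ anchorWords A k, ∀ l, T j l = if l = k then 1 else 0)
    (hsep : ∀ k, (anchorWords A k).Nonempty)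
    (hC : ∀ a b, a ≠ b → C a b + v ≤ C a a ∧ C a b + v ≤ C b b) (hd : 0 ≤ d) (hv : 4 * d < v)
    (hnon : ∀ j, j ∉ anchorSet A → ∀ k, 4 * d < (1 - T j k) * v)
    (hsymm : ∀ i j, R i j = R j i)
    (hclose : ∀ i j, |R i j - ∑ a, ∑ b, T i a * C a b * T j b| ≤ Q i j)
    (hQ : ∀ i j, Q i j ≤ d) (ha : IsArgmax R a) :
    ExactRecovery A (findAnchorWords R Q a) := by
  set S : Fin p → Fin p → ℝ := fun i j => ∑ a, ∑ b, T i a * C a b * T j b with hS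
  have hcl : ∀ i j, R i j ≤ S i j + Q i j ∧ S i j ≤ R i j + Q i j := fun i j => by
    have := abs_le.1 (hclose i j)
    constructor <;> linarith [this.1, this.2]
  have hSl : ∀ k, ∀ i ∈ anchorWords A k, ∀ j, S i j = ∑ b, C k b * T j b := by
    intro k i hi j
    simp only [hS, hanchor k i hi]
    simp
  have hSr : ∀ k, ∀ j ∈ anchorWords A k, ∀ i, S i j = ∑ a, T i a * C a k := by
    intro k j hj i
    simp only [hS, hanchor k j hj]
    simp
  have hSS : ∀ k, ∀ i ∈ anchorWords A k, ∀ j ∈ anchorWords A k, S i j = C k k := by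
    intro k i hi j hj
    rw [hSl k i hi]
    simp [hanchor k j hj]
  -- Averaging `c` with the weights `T j ·` loses at least `v` on the mass `1 - T j k` placed
  -- outside `k`.
  have hbound : ∀ (k : Fin K) (c : Fin K → ℝ), (∀ b, b ≠ k → c b + v ≤ c k) → ∀ j,
      ∑ b, T j b * c b ≤ c k - (1 - T j k) * v := by
    intro k c hc j
    have : ∀ b, T j b * c b ≤ T j b * (c k - v) + if b = k then T j b * v else 0 := by
      intro b
      by_cases h : b = k
      · subst h; simp; linarith
      · simp only [h, if_false, add_zero]
        exact mul_le_mul_of_nonneg_left (by linarith [hc b h]) (hT0 j b)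
    calc ∑ b, T j b * c b ≤ ∑ b, (T j b * (c k - v) + if b = k then T j b * v else 0) :=
          Finset.sum_le_sum fun b _ => this b
      _ = c k - (1 - T j k) * v := by
          rw [Finset.sum_add_distrib, ← Finset.sum_mul, hT1]; simp; ring
  have hT_le : ∀ j k, T j k ≤ 1 := fun j k => by
    rw [← hT1 j]; exact Finset.single_le_sum (fun b _ => hT0 j b) (Finset.mem_univ k)
  have hSl_le : ∀ k, ∀ i ∈ anchorWords A k, ∀ j, S i j ≤ C k k - (1 - T j k) * v := by
    intro k i hi j
    rw [hSl k i hi]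
    simp_rw [mul_comm (C k _)]
    exact hbound k (C k) (fun b hb => (hC k b hb.symm).1) j
  have hSr_le : ∀ k, ∀ j ∈ anchorWords A k, ∀ i, S i j ≤ C k k - (1 - T i k) * v := by
    intro k j hj i
    rw [hSr k j hj]
    exact hbound k (fun b => C b k) (fun b hb => (hC b k hb).2) i
  have hmax : ∀ k, ∀ i ∈ anchorWords A k, ∀ j, S i j ≤ C k k := by
    intro k i hi j
    have := hSl_le k i hi j
    nlinarith [hT_le j k]
  apply exactRecovery_of_candidate_eq hsep
  · intro k i hi
    have hcand : candidate R Q a i = anchorWords A k := by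
      ext l
      simp only [candidate, Finset.mem_filter, Finset.mem_univ, true_and]
      constructor
      · intro h
        -- The tolerances spent are one at `(i, i)`, one at `(i, a i)` and two at `(i, l)`.
        have h1 : C k k - 4 * d ≤ S i l := by
          have := hSS k i hi i hi
          linarith [(hcl i i).2, (hcl i l).1, ha i i, hQ i i, hQ i l, hQ i (a i)]
        have h2 := hSl_le k i hi l
        by_contra hl
        by_cases hlI : l ∈ anchorSet A
        · obtain ⟨b, hb⟩ := mem_anchorSet.1 hlI
          have hbk : k ≠ b := fun e => hl (e ▸ hb)
          rw [hanchor b l hb k, if_neg hbk] at h2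
          linarith
        · linarith [hnon l hlI k]
      · intro h
        linarith [(hcl i (a i)).1, (hcl i l).2, hmax k i hi (a i), hSS k i hi l h]
    refine ⟨fun j hj => ?_, hcand⟩
    rw [hcand] at hj
    rw [abs_le]
    constructor
    · linarith [(hcl j (a j)).1, (hcl i j).2, hmax k j hj (a j), hSS k i hi j hj]
    -- This side needs only symmetry: `R i j = R j i` never exceeds the maximum of row `j`.
    · have := ha j i
      rw [hsymm j i] at this
      have h0 : ∀ i j, 0 ≤ Q i j := fun i j => (abs_nonneg _).trans (hclose i j)
      linarith [h0 i j, h0 j (a j)]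
  · intro i hi hpass
    have hne : (Finset.univ : Finset (Fin K)).Nonempty := by
      by_contra h
      have := hT1 i
      rw [Finset.not_nonempty_iff_eq_empty.1 h] at this
      simp at this
    -- Row `i` of `S` averages these column values with the weights `T l ·`, hence is maximal at any
    -- anchor word of the best topic `k`.
    obtain ⟨k, -, hk⟩ := Finset.exists_max_image Finset.univ (fun b => ∑ a, T i a * C a b) hne
    obtain ⟨j, hj⟩ := hsep k
    have hSi : ∀ l, S i l ≤ S i j := by
      intro l
      rw [hSr k j hj]
      calc S i l = ∑ b, T l b * ∑ a, T i a * C a b := by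
            simp only [hS]
            rw [Finset.sum_comm]
            refine Finset.sum_congr rfl fun b _ => ?_
            rw [Finset.mul_sum]
            exact Finset.sum_congr rfl fun a _ => by ring
        _ ≤ ∑ b, T l b * ∑ a, T i a * C a k :=
            Finset.sum_le_sum fun b hb => mul_le_mul_of_nonneg_left (hk b hb) (hT0 l b)
        _ = ∑ a, T i a * C a k := by rw [← Finset.sum_mul, hT1, one_mul]
    have hjc : j ∈ candidate R Q a i := by
      simp only [candidate, Finset.mem_filter, Finset.mem_univ, true_and]
      linarith [(hcl i (a i)).1, (hcl i j).2, hSi (a i)]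
    have h1 := (abs_le.1 (hpass j hjc)).1
    have h2 := hSr_le k j hj i
    linarith [ha j j, hSS k j hj j hj, (hcl j j).2, (hcl i j).1, hnon i hi k, hQ j j, hQ i j,
      hQ j (a j)]

/-! ### The population matrix: convex weights, factorisation, separation. -/

theorem ColumnsAreProbabilities.mul {A : Matrix (Fin p) (Fin K) ℝ} {W : Matrix (Fin K) (Fin n) ℝ}
    (hA : ColumnsAreProbabilities A) (hW : ColumnsAreProbabilities W) :
    ColumnsAreProbabilities (A * W) := by
  refine ⟨fun i j => ?_, fun j => ?_⟩
  · rw [Matrix.mul_apply]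
    exact Finset.sum_nonneg fun k _ => mul_nonneg (hA.1 i k) (hW.1 k j)
  · simp_rw [Matrix.mul_apply]
    rw [Finset.sum_comm]
    simp_rw [← Finset.sum_mul, hA.2, one_mul]
    exact hW.2 j

theorem rowNorm_eq_sum {a b : ℕ} {B : Matrix (Fin a) (Fin b) ℝ} {i : Fin a}
    (h : ∀ j, 0 ≤ B i j) : rowNorm B i = ∑ j, B i j :=
  Finset.sum_congr rfl fun j _ => abs_of_nonneg (h j)

theorem rowNorm_mul_eq {A : Matrix (Fin p) (Fin K) ℝ} {W : Matrix (Fin K) (Fin n) ℝ}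
    (hA : ColumnsAreProbabilities A) (hW : ColumnsAreProbabilities W) (j : Fin p) :
    rowNorm (A * W) j = ∑ k, A j k * rowNorm W k := by
  rw [rowNorm_eq_sum ((hA.mul hW).1 j)]
  simp_rw [rowNorm_eq_sum (hW.1 _), Matrix.mul_apply, Finset.mul_sum]
  exact Finset.sum_comm

theorem Atilde_apply (A : Matrix (Fin p) (Fin K) ℝ) (W : Matrix (Fin K) (Fin n) ℝ) (j : Fin p)
    (k : Fin K) : Atilde A W j k = (rowNorm (A * W) j)⁻¹ * A j k * rowNorm W k := by
  simp [Atilde, Matrix.mul_diagonal, Matrix.diagonal_mul]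

theorem rowNorm_nonneg {a b : ℕ} (B : Matrix (Fin a) (Fin b) ℝ) (i : Fin a) : 0 ≤ rowNorm B i :=
  Finset.sum_nonneg fun _ _ => abs_nonneg _

theorem Atilde_nonneg {A : Matrix (Fin p) (Fin K) ℝ} (hA : ColumnsAreProbabilities A)
    (W : Matrix (Fin K) (Fin n) ℝ) (j : Fin p) (k : Fin K) : 0 ≤ Atilde A W j k := by
  rw [Atilde_apply]
  exact mul_nonneg (mul_nonneg (inv_nonneg.2 (rowNorm_nonneg _ _)) (hA.1 j k)) (rowNorm_nonneg _ _)

theorem sum_Atilde {A : Matrix (Fin p) (Fin K) ℝ} {W : Matrix (Fin K) (Fin n) ℝ}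
    (hA : ColumnsAreProbabilities A) (hW : ColumnsAreProbabilities W) {j : Fin p}
    (hj : 0 < rowNorm (A * W) j) : ∑ k, Atilde A W j k = 1 := by
  simp_rw [Atilde_apply, mul_assoc]
  rw [← Finset.mul_sum, ← rowNorm_mul_eq hA hW, inv_mul_cancel₀ hj.ne']

theorem Atilde_of_mem_anchorWords {A : Matrix (Fin p) (Fin K) ℝ} {W : Matrix (Fin K) (Fin n) ℝ}
    (hA : ColumnsAreProbabilities A) (hW : ColumnsAreProbabilities W) {j : Fin p}
    (hj : 0 < rowNorm (A * W) j) {k : Fin K} (h : j ∈ anchorWords A k) (l : Fin K) :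
    Atilde A W j l = if l = k then 1 else 0 := by
  obtain ⟨-, h2⟩ := mem_anchorWords.1 h
  have h0 : ∀ l, l ≠ k → Atilde A W j l = 0 := fun l hl => by rw [Atilde_apply, h2 l hl]; simp
  split_ifs with hl
  · subst hl
    rw [← sum_Atilde hA hW hj, Finset.sum_eq_single l (fun b _ hb => h0 b hb) (by simp)]
  · exact h0 l hl

/-- At an anchor word `Ã_{jk} = 1`, yet this entry is a multiple of the row norm of `W`, which
therefore cannot vanish. -/
theorem rowNorm_pos_of_anchorWords {A : Matrix (Fin p) (Fin K) ℝ} {W : Matrix (Fin K) (Fin n) ℝ}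
    (hA : ColumnsAreProbabilities A) (hW : ColumnsAreProbabilities W)
    (hpos : ∀ j, 0 < rowNorm (A * W) j) {k : Fin K} (h : (anchorWords A k).Nonempty) :
    0 < rowNorm W k := by
  obtain ⟨j, hj⟩ := h
  refine (rowNorm_nonneg W k).lt_of_ne fun e => ?_
  have h1 := Atilde_of_mem_anchorWords hA hW (hpos j) hj k
  rw [Atilde_apply, ← e] at h1
  simp at h1

/-- `Ã C̃ Ãᵀ` is the normalised version of `Θ`. -/
theorem sum_Atilde_Ctilde {A : Matrix (Fin p) (Fin K) ℝ} {W : Matrix (Fin K) (Fin n) ℝ}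
    (hA : ColumnsAreProbabilities A) (hW : ColumnsAreProbabilities W) (hn : 0 < n)
    (hWpos : ∀ k, 0 < rowNorm W k) (j l : Fin p) :
    ∑ a, ∑ b, Atilde A W j a * Ctilde W a b * Atilde A W l b
      = Theta (A * W) j l / (((n : ℝ)⁻¹ * ∑ i, (A * W) j i) * ((n : ℝ)⁻¹ * ∑ i, (A * W) l i)) := by
  -- The factors `D_W` and `D_W⁻¹` cancel, so `Ã W̃` is the row-normalised `Π`; the claim is its
  -- Gram matrix.
  have h1 : ∀ j i, ∑ a, Atilde A W j a * Wtilde W a i = (rowNorm (A * W) j)⁻¹ * (A * W) j i := by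
    intro j i
    rw [Matrix.mul_apply, Finset.mul_sum]
    refine Finset.sum_congr rfl fun a _ => ?_
    rw [Atilde_apply, Wtilde, Matrix.diagonal_mul]
    have := (hWpos a).ne'
    field_simp
  have h2 : ∀ a b, Ctilde W a b = n * ∑ i, Wtilde W a i * Wtilde W b i := by
    intro a b
    simp [Ctilde, Matrix.mul_apply]
  have h3 : ∑ a, ∑ b, Atilde A W j a * Ctilde W a b * Atilde A W l b
      = n * ∑ i, (∑ a, Atilde A W j a * Wtilde W a i) * ∑ b, Atilde A W l b * Wtilde W b i := by
    simp_rw [h2, Finset.sum_mul_sum, Finset.mul_sum, Finset.sum_mul]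
    rw [Finset.sum_comm' (t' := Finset.univ) (s' := fun _ => Finset.univ) (by simp)]
    rw [Finset.sum_congr rfl fun b _ => Finset.sum_comm, Finset.sum_comm]
    refine Finset.sum_congr rfl fun i _ => ?_
    rw [Finset.sum_comm]
    refine Finset.sum_congr rfl fun a _ => Finset.sum_congr rfl fun b _ => by ring
  rw [h3]
  simp_rw [h1]
  have hT : Theta (A * W) j l = (n : ℝ)⁻¹ * ∑ i, (A * W) j i * (A * W) l i := by
    rw [Theta, Matrix.smul_apply, Matrix.mul_apply]
    simp
  rw [hT, rowNorm_eq_sum ((hA.mul hW).1 j), rowNorm_eq_sum ((hA.mul hW).1 l)]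
  have : ∑ i, (∑ x, (A * W) j x)⁻¹ * (A * W) j i * ((∑ x, (A * W) l x)⁻¹ * (A * W) l i)
      = (∑ x, (A * W) j x)⁻¹ * (∑ x, (A * W) l x)⁻¹ * ∑ i, (A * W) j i * (A * W) l i := by
    rw [Finset.mul_sum]
    exact Finset.sum_congr rfl fun i _ => by ring
  rw [this]
  have hn' : (n : ℝ) ≠ 0 := by positivity
  rw [div_eq_mul_inv, mul_inv, mul_inv, mul_inv, inv_inv]
  field_simp

theorem Ctilde_symm (W : Matrix (Fin K) (Fin n) ℝ) (a b : Fin K) :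
    Ctilde W a b = Ctilde W b a := by
  simp [Ctilde, Matrix.mul_apply, mul_comm]

/-- A real separation constant that works for all pairs of topics and excludes quasi-anchor
words. -/
theorem exists_separation {N : ℕ} {A : Matrix (Fin p) (Fin K) ℝ} {W : Matrix (Fin K) (Fin n) ℝ}
    (hA : ColumnsAreProbabilities A) (hW : ColumnsAreProbabilities W)
    (hpos : ∀ j, 0 < rowNorm (A * W) j) (hd : 0 ≤ delta N (A * W))
    (hnu : ((4 * delta N (A * W) : ℝ) : EReal) < nu W)
    (hJ1 : quasiAnchor N A W = ∅) :
    ∃ v : ℝ, 4 * delta N (A * W) < v ∧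
      (∀ a b, a ≠ b → Ctilde W a b + v ≤ Ctilde W a a ∧ Ctilde W a b + v ≤ Ctilde W b b) ∧
      ∀ j, j ∉ anchorSet A → ∀ k, 4 * delta N (A * W) < (1 - Atilde A W j k) * v := by
  have hJ : ∀ j, j ∉ anchorSet A → ∀ k, ((Atilde A W j k : ℝ) : EReal) <
      (1 : EReal) - ((4 * delta N (A * W) : ℝ) : EReal) / nu W := by
    intro j hj k
    by_contra h
    have : j ∈ quasiAnchor N A W := ⟨hj, k, not_lt.1 h⟩
    rw [hJ1] at this
    exact this
  have hle : ∀ a b, a < b → nu W ≤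
      ((min (Ctilde W a a) (Ctilde W b b) - Ctilde W a b : ℝ) : EReal) :=
    fun a b h => iInf_le_of_le a (iInf_le_of_le b (iInf_le _ h))
  by_cases htop : nu W = ⊤
  -- A real-valued gap for any pair would make `ν` finite, so there is at most one topic and any `v`
  -- above `4δ` separates. All entries of `Ã` are then `1`, and the absence of quasi-anchor words,
  -- read with `4δ / ⊤ = 0`, excludes non-anchor words.
  · have hK : ∀ a b : Fin K, a = b := by
      intro a b
      by_contra h
      rcases lt_or_gt_of_ne h with h | h
      · have := hle _ _ h; rw [htop, top_le_iff] at this; exact EReal.coe_ne_top _ this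
      · have := hle _ _ h; rw [htop, top_le_iff] at this; exact EReal.coe_ne_top _ this
    refine ⟨4 * delta N (A * W) + 1, by linarith, fun a b h => absurd (hK a b) h, ?_⟩
    intro j hj k
    have h1 := hJ j hj k
    rw [htop, EReal.div_top, sub_zero] at h1
    have h2 : Atilde A W j k = 1 := by
      rw [← sum_Atilde hA hW (hpos j), Finset.sum_eq_single k (fun b _ hb => absurd (hK b k) hb)
        (by simp)]
    rw [h2] at h1
    exact absurd h1 (by simp)
  · obtain ⟨v, hv⟩ : ∃ v : ℝ, nu W = (v : EReal) := by
      lift nu W to ℝ using ⟨htop, (bot_lt_of_lt hnu).ne'⟩ with v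
      exact ⟨v, rfl⟩
    rw [hv] at hnu hJ hle
    have hv4 : 4 * delta N (A * W) < v := by exact_mod_cast hnu
    refine ⟨v, hv4, ?_, ?_⟩
    · have key : ∀ a b, a < b →
          Ctilde W a b + v ≤ Ctilde W a a ∧ Ctilde W a b + v ≤ Ctilde W b b := by
        intro a b h
        have := EReal.coe_le_coe_iff.1 (hle a b h)
        constructor
        · linarith [min_le_left (Ctilde W a a) (Ctilde W b b)]
        · linarith [min_le_right (Ctilde W a a) (Ctilde W b b)]
      intro a b h
      rcases lt_or_gt_of_ne h with h | h
      · exact key a b h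
      · rw [Ctilde_symm]; exact (key b a h).symm
    · intro j hj k
      have h1 := hJ j hj k
      have hv0 : 0 < v := by linarith
      rw [← EReal.coe_div, ← EReal.coe_one, ← EReal.coe_sub, EReal.coe_lt_coe_iff] at h1
      have : 4 * delta N (A * W) / v < 1 - Atilde A W j k := by linarith
      rwa [div_lt_iff₀ hv0] at this

theorem deltaEntry_le_delta (N : ℕ) (Pm : Matrix (Fin p) (Fin n) ℝ) (j l : Fin p) :
    deltaEntry N Pm j l ≤ delta N Pm :=
  le_ciSup (f := fun q : Fin p × Fin p => deltaEntry N Pm q.1 q.2) (Set.finite_range _).bddAbove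
    (j, l)

theorem RHat_symm (N : ℕ) (X : Matrix (Fin p) (Fin n) ℝ) (i j : Fin p) :
    RHat N X i j = RHat N X j i := by
  have h : ThetaHat N X i j = ThetaHat N X j i := by
    simp only [ThetaHat, Matrix.smul_apply, Matrix.sum_apply, Matrix.sub_apply,
      Matrix.vecMulVec_apply, Matrix.diagonal_apply, smul_eq_mul]
    congr 1
    refine Finset.sum_congr rfl fun k _ => ?_
    rcases eq_or_ne i j with rfl | h
    · rfl
    · simp [h, h.symm, mul_comm]
  simp only [RHat, Matrix.mul_diagonal, Matrix.diagonal_mul]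
  rw [h]; ring

/-- The algorithm succeeds as soon as `R̂` is entrywise within the tolerances of its population
version. -/
theorem exactRecovery_of_RHat_close {N : ℕ} {A : Matrix (Fin p) (Fin K) ℝ}
    {W : Matrix (Fin K) (Fin n) ℝ} {X : Matrix (Fin p) (Fin n) ℝ}
    (hA : ColumnsAreProbabilities A) (hW : ColumnsAreProbabilities W) (hn : 0 < n) (hp : 0 < p)
    (hsep : ∀ k : Fin K, ∃ j : Fin p, 0 < A j k ∧ ∀ l, l ≠ k → A j l = 0)
    (hpos : ∀ j, 0 < ∑ i, (A * W) j i)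
    (hnu : ((4 * delta N (A * W) : ℝ) : EReal) < nu W)
    (hJ1 : quasiAnchor N A W = ∅)
    (hclose : ∀ j l, |RHat N X j l
      - Theta (A * W) j l / (((n : ℝ)⁻¹ * ∑ i, (A * W) j i) * ((n : ℝ)⁻¹ * ∑ i, (A * W) l i))|
        ≤ deltaEntry N (A * W) j l)
    {a : Fin p → Fin p} (ha : IsArgmax (RHat N X) a) :
    ExactRecovery A (findAnchorWords (RHat N X) (Matrix.of (deltaEntry N (A * W))) a) := by
  have hpos' : ∀ j, 0 < rowNorm (A * W) j := fun j => by
    rw [rowNorm_eq_sum ((hA.mul hW).1 j)]; exact hpos j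
  have hsep' : ∀ k, (anchorWords A k).Nonempty := fun k => by
    obtain ⟨j, hj⟩ := hsep k
    exact ⟨j, mem_anchorWords.2 hj⟩
  have hd : 0 ≤ delta N (A * W) :=
    ((abs_nonneg _).trans (hclose ⟨0, hp⟩ ⟨0, hp⟩)).trans (deltaEntry_le_delta _ _ _ _)
  obtain ⟨v, hv, hC, hnon⟩ := exists_separation hA hW hpos' hd hnu hJ1
  refine exactRecovery_of_entrywise_close (T := Atilde A W) (C := Ctilde W) (d := delta N (A * W))
    (v := v) (Atilde_nonneg hA W) (fun j => sum_Atilde hA hW (hpos' j))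
    (fun k j hj l => Atilde_of_mem_anchorWords hA hW (hpos' j) hj l) hsep' hC hd hv hnon
    (RHat_symm N X) (fun i j => ?_) (fun i j => ?_) ha
  · rw [sum_Atilde_Ctilde hA hW hn fun k => rowNorm_pos_of_anchorWords hA hW hpos' (hsep' k)]
    exact hclose i j
  · exact deltaEntry_le_delta N (A * W) i j

/-! ### Moments and generating functions of the multinomial distribution. -/

/-- The count vectors with total `N`. -/
abbrev countVectors (p N : ℕ) : Finset (Fin p → ℕ) := Finset.piAntidiag Finset.univ N

theorem mem_countVectors {N : ℕ} {y : Fin p → ℕ} : y ∈ countVectors p N ↔ ∑ j, y j = N := by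
  simp [Finset.mem_piAntidiag]

/-- The multinomial theorem. Putting `x = exp c` and differentiating in `c` yields all the moments
used below. -/
theorem sum_multinomialProb_mul_prod_pow (N : ℕ) (q x : Fin p → ℝ) :
    ∑ y ∈ countVectors p N, multinomialProb N q y * ∏ j, x j ^ y j = (∑ j, q j * x j) ^ N := by
  rw [Finset.sum_pow_eq_sum_piAntidiag]
  refine Finset.sum_congr rfl fun y hy => ?_
  rw [multinomialProb, if_pos (mem_countVectors.1 hy), mul_assoc, ← Finset.prod_mul_distrib]
  simp_rw [mul_pow]

/-- The exponential generating function of a multinomial vector in direction `c`, with weights. -/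
theorem sum_multinomialProb_mul_exp (N : ℕ) (q c : Fin p → ℝ) :
    ∑ y ∈ countVectors p N, multinomialProb N q y * Real.exp (∑ j, c j * y j)
      = (∑ j, q j * Real.exp (c j)) ^ N := by
  rw [← sum_multinomialProb_mul_prod_pow]
  refine Finset.sum_congr rfl fun y _ => ?_
  rw [Real.exp_sum]
  simp_rw [← Real.exp_nat_mul, mul_comm]

/-- Both sides are the derivative at `0`, in the direction of the coordinate `a`, of the exponential
generating function. -/
theorem sum_multinomialProb_mul_exp_mul_apply (N : ℕ) (q c : Fin p → ℝ) (a : Fin p) :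
    ∑ y ∈ countVectors p N, multinomialProb N q y * (Real.exp (∑ j, c j * y j) * y a)
      = N * (∑ j, q j * Real.exp (c j)) ^ (N - 1) * (q a * Real.exp (c a)) := by
  set e : Fin p → ℝ := Pi.single a 1 with he
  have h1 : HasDerivAt (fun u : ℝ => ∑ y ∈ countVectors p N,
      multinomialProb N q y * Real.exp (∑ j, (c j + u * e j) * y j))
      (∑ y ∈ countVectors p N, multinomialProb N q y * (Real.exp (∑ j, c j * y j) * y a)) 0 := by
    refine HasDerivAt.fun_sum fun y _ => HasDerivAt.const_mul _ ?_
    have h : HasDerivAt (fun u : ℝ => ∑ j, (c j + u * e j) * (y j : ℝ)) (∑ j, e j * (y j : ℝ)) 0 := by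
      refine HasDerivAt.fun_sum fun j _ => ?_
      simpa using ((((hasDerivAt_id (0 : ℝ)).mul_const (e j)).const_add (c j)).mul_const (y j : ℝ))
    have h2 := h.exp
    simpa [he, Pi.single_apply] using h2
  have h2 : HasDerivAt (fun u : ℝ => (∑ j, q j * Real.exp (c j + u * e j)) ^ N)
      (N * (∑ j, q j * Real.exp (c j)) ^ (N - 1) * (q a * Real.exp (c a))) 0 := by
    have h : HasDerivAt (fun u : ℝ => ∑ j, q j * Real.exp (c j + u * e j))
        (∑ j, q j * (Real.exp (c j) * e j)) 0 := by
      refine HasDerivAt.fun_sum fun j _ => HasDerivAt.const_mul _ ?_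
      simpa using (((hasDerivAt_id (0 : ℝ)).mul_const (e j)).const_add (c j)).exp
    have h3 := h.fun_pow N
    simpa [he, Pi.single_apply] using h3
  simp_rw [sum_multinomialProb_mul_exp N q] at h1
  exact h1.unique h2

theorem sum_multinomialProb_mul_apply {N : ℕ} {q : Fin p → ℝ} (hq : ∑ j, q j = 1) (a : Fin p) :
    ∑ y ∈ countVectors p N, multinomialProb N q y * (y a : ℝ) = N * q a := by
  have := sum_multinomialProb_mul_exp_mul_apply N q 0 a
  simpa [hq] using this

/-- A second differentiation, in the direction `b` and at the origin. The extra diagonal term comes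
from differentiating `exp (c a)`. -/
theorem sum_multinomialProb_mul_apply_mul_apply {N : ℕ} {q : Fin p → ℝ} (hq : ∑ j, q j = 1)
    (hN : 1 ≤ N) (a b : Fin p) :
    ∑ y ∈ countVectors p N, multinomialProb N q y * ((y a : ℝ) * y b)
      = N * (N - 1) * (q a * q b) + if a = b then N * q a else 0 := by
  set e : Fin p → ℝ := Pi.single b 1 with he
  have h1 : HasDerivAt (fun u : ℝ => ∑ y ∈ countVectors p N,
      multinomialProb N q y * (Real.exp (∑ j, (u * e j) * y j) * y a))
      (∑ y ∈ countVectors p N, multinomialProb N q y * ((y a : ℝ) * y b)) 0 := by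
    refine HasDerivAt.fun_sum fun y _ => HasDerivAt.const_mul _ ?_
    have h : HasDerivAt (fun u : ℝ => ∑ j, (u * e j) * (y j : ℝ)) (∑ j, e j * (y j : ℝ)) 0 := by
      refine HasDerivAt.fun_sum fun j _ => ?_
      simpa using (((hasDerivAt_id (0 : ℝ)).mul_const (e j)).mul_const (y j : ℝ))
    have h2 := h.exp.mul_const (y a : ℝ)
    simpa [he, Pi.single_apply, mul_comm] using h2
  have h2 : HasDerivAt (fun u : ℝ => N * (∑ j, q j * Real.exp (u * e j)) ^ (N - 1)
      * (q a * Real.exp (u * e a)))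
      (N * (N - 1) * (q a * q b) + if a = b then N * q a else 0) 0 := by
    have hexp : ∀ j, HasDerivAt (fun u : ℝ => q j * Real.exp (u * e j)) (q j * e j) 0 := by
      intro j
      simpa using (((hasDerivAt_id (0 : ℝ)).mul_const (e j)).exp).const_mul (q j)
    have h : HasDerivAt (fun u : ℝ => ∑ j, q j * Real.exp (u * e j)) (∑ j, q j * e j) 0 :=
      HasDerivAt.fun_sum fun j _ => hexp j
    have h3 := (((h.fun_pow (N - 1)).const_mul (N : ℝ)).mul (hexp a))
    refine h3.congr_deriv ?_
    simp only [zero_mul, Real.exp_zero, mul_one, hq, one_pow]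
    simp only [he, Pi.single_apply]
    push_cast [Nat.cast_sub hN]
    split_ifs <;> simp <;> ring
  have h3 : (fun u : ℝ => ∑ y ∈ countVectors p N,
      multinomialProb N q y * (Real.exp (∑ j, (u * e j) * y j) * y a))
      = fun u : ℝ => N * (∑ j, q j * Real.exp (u * e j)) ^ (N - 1)
      * (q a * Real.exp (u * e a)) := by
    funext u
    exact sum_multinomialProb_mul_exp_mul_apply N q (fun j => u * e j) a
  rw [h3] at h1
  exact h1.unique h2

section Expectation

variable {Ω : Type*} [MeasurableSpace Ω] {P : Measure Ω} [IsProbabilityMeasure P] {N : ℕ}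
  {q : Fin p → ℝ} {Z : Ω → Fin p → ℕ}

theorem ae_mem_countVectors
    (hlaw : ∀ y, P.real {ω | Z ω = y} = multinomialProb N q y) :
    ∀ᵐ ω ∂P, Z ω ∈ countVectors p N := by
  have : ∀ᵐ ω ∂P, ∀ y : Fin p → ℕ, y ∉ countVectors p N → Z ω ≠ y := by
    rw [ae_all_iff]
    intro y
    by_cases hy : y ∈ countVectors p N
    · simp [hy]
    · have h0 : P.real {ω | Z ω = y} = 0 := by
        rw [hlaw y, multinomialProb, if_neg (fun h => hy (mem_countVectors.2 h))]
      rw [measureReal_eq_zero_iff] at h0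
      have : ∀ᵐ ω ∂P, ¬ Z ω = y := by
        rw [ae_iff]; simpa using h0
      filter_upwards [this] with ω hω _ using hω
  filter_upwards [this] with ω hω
  by_contra h
  exact hω _ h rfl

theorem integrable_comp_multinomial (hZ : Measurable Z)
    (hlaw : ∀ y, P.real {ω | Z ω = y} = multinomialProb N q y) (f : (Fin p → ℕ) → ℝ) :
    Integrable (fun ω => f (Z ω)) P := by
  refine Integrable.of_bound (C := ∑ y ∈ countVectors p N, |f y|)
    ((measurable_of_countable f).comp hZ).aestronglyMeasurable ?_
  filter_upwards [ae_mem_countVectors hlaw] with ω hω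
  exact Finset.single_le_sum (f := fun y => |f y|) (fun y _ => abs_nonneg _) hω

theorem integral_comp_multinomial (hZ : Measurable Z)
    (hlaw : ∀ y, P.real {ω | Z ω = y} = multinomialProb N q y) (f : (Fin p → ℕ) → ℝ) :
    ∫ ω, f (Z ω) ∂P = ∑ y ∈ countVectors p N, multinomialProb N q y * f y := by
  rw [← integral_map hZ.aemeasurable (measurable_of_countable f).aestronglyMeasurable]
  have hae : ∀ᵐ y ∂(P.map Z), y ∈ (countVectors p N : Set (Fin p → ℕ)) := by
    refine (ae_map_iff (p := fun y => y ∈ (countVectors p N : Set (Fin p → ℕ))) hZ.aemeasurable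
      (Finset.measurableSet _)).2 ?_
    exact ae_mem_countVectors hlaw
  have : IsProbabilityMeasure (P.map Z) := Measure.isProbabilityMeasure_map hZ.aemeasurable
  rw [← Measure.restrict_eq_self_of_ae_mem hae, setIntegral_finset _ IntegrableOn.finset]
  refine Finset.sum_congr rfl fun y _ => ?_
  rw [map_measureReal_apply hZ (measurableSet_singleton y), ← hlaw y]
  rfl

/-- The generating function is an `N`-th power of a quantity `1 + x`, and `1 + x ≤ exp x` replaces
it by its Poisson counterpart, in which the coordinates decouple. -/
theorem mgf_linear_multinomial_le (hZ : Measurable Z)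
    (hlaw : ∀ y, P.real {ω | Z ω = y} = multinomialProb N q y) (hq0 : ∀ j, 0 ≤ q j)
    (hq : ∑ j, q j = 1) (c : Fin p → ℝ) (u : ℝ) :
    mgf (fun ω => ∑ j, c j * ((Z ω j : ℝ) - N * q j)) P u
      ≤ Real.exp (N * ∑ j, q j * (Real.exp (u * c j) - 1 - u * c j)) := by
  rw [mgf, integral_comp_multinomial hZ hlaw
    (fun y => Real.exp (u * ∑ j, c j * ((y j : ℝ) - N * q j)))]
  have h1 : ∀ y : Fin p → ℕ, Real.exp (u * ∑ j, c j * ((y j : ℝ) - N * q j))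
      = Real.exp (∑ j, (u * c j) * y j) * Real.exp (- (N * ∑ j, q j * (u * c j))) := by
    intro y
    rw [← Real.exp_add]
    congr 1
    rw [Finset.mul_sum, Finset.mul_sum, ← Finset.sum_neg_distrib, ← Finset.sum_add_distrib]
    exact Finset.sum_congr rfl fun j _ => by ring
  simp_rw [h1, ← mul_assoc (multinomialProb _ _ _)]
  rw [← Finset.sum_mul, sum_multinomialProb_mul_exp]
  have h2 : ∑ j, q j * Real.exp (u * c j) ≤ Real.exp (∑ j, q j * (Real.exp (u * c j) - 1)) := by
    have : ∑ j, q j * Real.exp (u * c j) = ∑ j, q j * (Real.exp (u * c j) - 1) + 1 := by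
      simp [mul_sub, Finset.sum_sub_distrib, hq]
    rw [this]
    exact Real.add_one_le_exp _
  have h3 : 0 ≤ ∑ j, q j * Real.exp (u * c j) :=
    Finset.sum_nonneg fun j _ => mul_nonneg (hq0 j) (Real.exp_pos _).le
  calc (∑ j, q j * Real.exp (u * c j)) ^ N * Real.exp (- (N * ∑ j, q j * (u * c j)))
      ≤ Real.exp (∑ j, q j * (Real.exp (u * c j) - 1)) ^ N
          * Real.exp (- (N * ∑ j, q j * (u * c j))) := by gcongr
    _ = _ := by
        rw [← Real.exp_nat_mul, ← Real.exp_add]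
        congr 1
        rw [← mul_neg, ← mul_add, ← Finset.sum_neg_distrib, ← Finset.sum_add_distrib]
        congr 1
        exact Finset.sum_congr rfl fun j _ => by ring

end Expectation

/-! ### Bernstein's inequality for multinomial samples. -/

/-- Termwise comparison of the exponential series with a geometric one, by `(k + 2)! ≥ 2 * 3 ^ k`.
This is the source of the `b / 3` in Bernstein's inequality. -/
theorem exp_sub_one_sub_le {x z : ℝ} (hx : |x| ≤ z) (hz : z < 3) :
    Real.exp x - 1 - x ≤ x ^ 2 / (2 * (1 - z / 3)) := by
  have hz0 : 0 ≤ z := (abs_nonneg x).trans hx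
  have h1 : HasSum (fun k : ℕ => x ^ k / (k.factorial : ℝ)) (Real.exp x) := by
    rw [Real.exp_eq_exp_ℝ]; exact NormedSpace.expSeries_div_hasSum_exp x
  have h2 : HasSum (fun k : ℕ => x ^ (k + 2) / ((k + 2).factorial : ℝ)) (Real.exp x - 1 - x) := by
    have := (hasSum_nat_add_iff' 2).2 h1
    simpa [Finset.sum_range_succ, sub_sub] using this
  have h3 : HasSum (fun k : ℕ => x ^ 2 / 2 * (z / 3) ^ k) (x ^ 2 / 2 * (1 - z / 3)⁻¹) :=
    (hasSum_geometric_of_lt_one (by positivity) (by linarith)).mul_left _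
  have h4 := hasSum_le (fun k => ?_) h2 h3
  · refine h4.trans (le_of_eq ?_)
    have : 1 - z / 3 ≠ 0 := by linarith
    field_simp
  · have hf : (2 : ℝ) * 3 ^ k ≤ ((k + 2).factorial : ℝ) := by
      have := @Nat.factorial_mul_pow_le_factorial 2 k
      rw [add_comm 2 k] at this
      exact_mod_cast this
    have hpow : x ^ k ≤ z ^ k :=
      (le_abs_self _).trans (by rw [abs_pow]; exact pow_le_pow_left₀ (abs_nonneg x) hx k)
    rw [div_pow, div_mul_div_comm, pow_add, mul_comm (x ^ k)]
    exact div_le_div₀ (by positivity) (mul_le_mul_of_nonneg_left hpow (sq_nonneg x))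
      (by positivity) hf

/-- The optimal Chernoff exponent for a sub-gamma moment generating function. -/
theorem exists_chernoff_exponent {V c t : ℝ} (hV : 0 < V) (hc : 0 < c) (ht : 0 < t) :
    ∃ u, 0 ≤ u ∧ c * u < 1 ∧
      -u * (√(2 * V * t) + c * t) + u ^ 2 * V / (2 * (1 - c * u)) = -t := by
  -- The witness `u = s / (1 + c s)` gives `1 - c u = 1 / (1 + c s)`, which makes the exponent equal
  -- to `-t` exactly.
  set s := √(2 * t / V) with hs
  have hs0 : 0 < s := Real.sqrt_pos.2 (by positivity)
  have hs2 : s ^ 2 * V = 2 * t := by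
    rw [hs, Real.sq_sqrt (by positivity)]; field_simp
  have h1 : √(2 * V * t) = s * V := by
    rw [Real.sqrt_eq_iff_mul_self_eq (by positivity) (by positivity)]
    linear_combination -V * hs2
  have h2 : 0 < 1 + c * s := by positivity
  refine ⟨s / (1 + c * s), by positivity, ?_, ?_⟩
  · rw [← mul_div_assoc, div_lt_one h2]; linarith
  · rw [h1]
    have : 1 - c * (s / (1 + c * s)) = (1 + c * s)⁻¹ := by field_simp; ring
    rw [this]
    field_simp
    linear_combination (-1 : ℝ) * hs2

section Tail

variable {Ω : Type*} [MeasurableSpace Ω] {P : Measure Ω} [IsProbabilityMeasure P] {N : ℕ}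
  {Pm : Matrix (Fin p) (Fin n) ℝ} {Y : Fin n → Ω → (Fin p → ℕ)}

/-- Independence multiplies the Poisson-type bounds of the documents, and `exp_sub_one_sub_le` turns
their sum into a sub-gamma exponent with variance `V` and scale `b / 3`. -/
theorem mgf_linear_sample_le (hY : IsMultinomialSample P N Pm Y) (hPm : ColumnsAreProbabilities Pm)
    {c : Fin p → Fin n → ℝ} {b V u : ℝ} (hc : ∀ j i, |c j i| ≤ b)
    (hV : N * ∑ i, ∑ j, Pm j i * c j i ^ 2 ≤ V) (hu : 0 ≤ u) (hub : b / 3 * u < 1) :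
    mgf (fun ω => ∑ i, ∑ j, c j i * ((Y i ω j : ℝ) - N * Pm j i)) P u
      ≤ Real.exp (u ^ 2 * V / (2 * (1 - b / 3 * u))) := by
  have hind : iIndepFun (fun i ω => ∑ j, c j i * ((Y i ω j : ℝ) - N * Pm j i)) P :=
    hY.indep.comp (fun i y => ∑ j, c j i * ((y j : ℝ) - N * Pm j i))
      fun i => measurable_of_countable _
  have hmeas : ∀ i, Measurable fun ω => ∑ j, c j i * ((Y i ω j : ℝ) - N * Pm j i) := fun i =>
    (measurable_of_countable fun y : Fin p → ℕ => ∑ j, c j i * ((y j : ℝ) - N * Pm j i)).comp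
      (hY.measurable i)
  have h := hind.mgf_sum (t := u) hmeas Finset.univ
  have hfun : (fun ω => ∑ i, ∑ j, c j i * ((Y i ω j : ℝ) - N * Pm j i))
      = ∑ i, fun ω => ∑ j, c j i * ((Y i ω j : ℝ) - N * Pm j i) := by
    funext ω; simp
  rw [hfun, h]
  calc ∏ i, mgf (fun ω => ∑ j, c j i * ((Y i ω j : ℝ) - N * Pm j i)) P u
      ≤ ∏ i, Real.exp (N * ∑ j, Pm j i * (Real.exp (u * c j i) - 1 - u * c j i)) :=
        Finset.prod_le_prod (fun i _ => mgf_nonneg) fun i _ =>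
          mgf_linear_multinomial_le (q := fun j => Pm j i) (hY.measurable i) (hY.law i)
            (fun j => hPm.1 j i) (hPm.2 i) (fun j => c j i) u
    _ ≤ _ := by
        rw [← Real.exp_sum, Real.exp_le_exp]
        have hden : 0 < 2 * (1 - b / 3 * u) := by linarith
        have h1 : ∀ i j, Pm j i * (Real.exp (u * c j i) - 1 - u * c j i)
            ≤ Pm j i * c j i ^ 2 * (u ^ 2 / (2 * (1 - b / 3 * u))) := by
          intro i j
          have := exp_sub_one_sub_le (x := u * c j i) (z := u * b) (by
            rw [abs_mul, abs_of_nonneg hu]; exact mul_le_mul_of_nonneg_left (hc j i) hu)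
            (by linarith)
          rw [mul_assoc]
          refine mul_le_mul_of_nonneg_left (this.trans (le_of_eq ?_)) (hPm.1 j i)
          rw [mul_pow, show u * b / 3 = b / 3 * u by ring]; ring
        calc ∑ i, (N : ℝ) * ∑ j, Pm j i * (Real.exp (u * c j i) - 1 - u * c j i)
            ≤ ∑ i, (N : ℝ) * ∑ j, Pm j i * c j i ^ 2 * (u ^ 2 / (2 * (1 - b / 3 * u))) := by
              exact Finset.sum_le_sum fun i _ => mul_le_mul_of_nonneg_left
                (Finset.sum_le_sum fun j _ => h1 i j) (Nat.cast_nonneg N)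
          _ = (N * ∑ i, ∑ j, Pm j i * c j i ^ 2) * (u ^ 2 / (2 * (1 - b / 3 * u))) := by
              simp_rw [← Finset.sum_mul]
              rw [Finset.mul_sum, Finset.sum_mul]
              exact Finset.sum_congr rfl fun i _ => by ring
          _ ≤ V * (u ^ 2 / (2 * (1 - b / 3 * u))) := by gcongr
          _ = _ := by ring

/-- Bernstein's inequality for linear functionals of a multinomial sample, upper tail. -/
theorem bernstein_multinomial (hY : IsMultinomialSample P N Pm Y)
    (hPm : ColumnsAreProbabilities Pm) {c : Fin p → Fin n → ℝ} {b V t : ℝ} (hb : 0 < b)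
    (hc : ∀ j i, |c j i| ≤ b) (hV : N * ∑ i, ∑ j, Pm j i * c j i ^ 2 ≤ V) (ht : 0 < t) :
    P.real {ω | √(2 * V * t) + b / 3 * t ≤ ∑ i, ∑ j, c j i * ((Y i ω j : ℝ) - N * Pm j i)}
      ≤ Real.exp (-t) := by
  have hmeas : Measurable fun ω => ∑ i, ∑ j, c j i * ((Y i ω j : ℝ) - N * Pm j i) :=
    Finset.measurable_sum _ fun i _ =>
      (measurable_of_countable fun y : Fin p → ℕ => ∑ j, c j i * ((y j : ℝ) - N * Pm j i)).comp
        (hY.measurable i)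
  have hbound : ∀ᵐ ω ∂P, |∑ i, ∑ j, c j i * ((Y i ω j : ℝ) - N * Pm j i)|
      ≤ ∑ i : Fin n, ∑ y ∈ countVectors p N, |∑ j, c j i * ((y j : ℝ) - N * Pm j i)| := by
    have h : ∀ᵐ ω ∂P, ∀ i, Y i ω ∈ countVectors p N :=
      ae_all_iff.2 fun i => ae_mem_countVectors (hY.law i)
    filter_upwards [h] with ω hω
    exact (Finset.abs_sum_le_sum_abs _ _).trans (Finset.sum_le_sum fun i _ =>
      Finset.single_le_sum (f := fun y : Fin p → ℕ => |∑ j, c j i * ((y j : ℝ) - N * Pm j i)|)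
        (fun y _ => abs_nonneg _) (hω i))
  have hint : ∀ u, Integrable
      (fun ω => Real.exp (u * ∑ i, ∑ j, c j i * ((Y i ω j : ℝ) - N * Pm j i))) P := fun u =>
    integrable_exp_mul_of_mem_Icc hmeas.aemeasurable (by
      filter_upwards [hbound] with ω hω using abs_le.1 hω)
  have hchern : ∀ V', N * ∑ i, ∑ j, Pm j i * c j i ^ 2 ≤ V' → ∀ x u, 0 ≤ u → b / 3 * u < 1 →
      P.real {ω | x ≤ ∑ i, ∑ j, c j i * ((Y i ω j : ℝ) - N * Pm j i)}
        ≤ Real.exp (-u * x + u ^ 2 * V' / (2 * (1 - b / 3 * u))) := by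
    intro V' hV' x u hu hub
    refine (measure_ge_le_exp_mul_mgf x hu (hint u)).trans ?_
    rw [Real.exp_add]
    exact mul_le_mul_of_nonneg_left (mgf_linear_sample_le hY hPm hc hV' hu hub) (Real.exp_pos _).le
  have hV0 : 0 ≤ V := le_trans (mul_nonneg (Nat.cast_nonneg _) (Finset.sum_nonneg fun i _ =>
    Finset.sum_nonneg fun j _ => mul_nonneg (hPm.1 j i) (sq_nonneg _))) hV
  rcases hV0.eq_or_lt with hV0 | hV0
  -- With zero variance no admissible exponent is optimal: the bound `exp (-u * (b / 3 * t))`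
  -- reaches `exp (-t)` only as `u` increases to the excluded value `3 / b`.
  · subst hV0
    have hlim : Filter.Tendsto (fun u : ℝ => Real.exp (-u * (b / 3 * t))) (nhdsWithin (3 / b)
        (Set.Iio (3 / b))) (nhds (Real.exp (-t))) := by
      have : Real.exp (-t) = Real.exp (-(3 / b) * (b / 3 * t)) := by
        congr 1; field_simp
      rw [this]
      exact (Continuous.tendsto (by fun_prop) _).mono_left nhdsWithin_le_nhds
    refine ge_of_tendsto hlim ?_
    have hpos : 0 < 3 / b := by positivity
    filter_upwards [Ioo_mem_nhdsLT hpos] with u hu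
    have hu1 : b / 3 * u < 1 := by
      have := (lt_div_iff₀ hb).1 hu.2
      linarith
    have := hchern 0 hV (√(2 * 0 * t) + b / 3 * t) u hu.1.le hu1
    simpa using this
  · obtain ⟨u, hu, hub, he⟩ := exists_chernoff_exponent (c := b / 3) hV0 (by positivity) ht
    rw [← he]
    exact hchern V hV _ u hu hub

/-- Bernstein's inequality for linear functionals of a multinomial sample. -/
theorem bernstein_multinomial_abs (hY : IsMultinomialSample P N Pm Y)
    (hPm : ColumnsAreProbabilities Pm) {c : Fin p → Fin n → ℝ} {b V t : ℝ} (hb : 0 < b)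
    (hc : ∀ j i, |c j i| ≤ b) (hV : N * ∑ i, ∑ j, Pm j i * c j i ^ 2 ≤ V) (ht : 0 < t) :
    P.real {ω | √(2 * V * t) + b / 3 * t < |∑ i, ∑ j, c j i * ((Y i ω j : ℝ) - N * Pm j i)|}
      ≤ 2 * Real.exp (-t) := by
  have h1 := bernstein_multinomial hY hPm hb hc hV ht
  have h2 := bernstein_multinomial hY hPm (c := fun j i => - c j i) hb (by simpa using hc)
    (by simpa using hV) ht
  refine (measureReal_mono ?_).trans ((measureReal_union_le _ _).trans
    ((add_le_add h1 h2).trans (le_of_eq (by ring))))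
  intro ω hω
  simp only [neg_mul, Finset.sum_neg_distrib]
  rcases lt_abs.1 (Set.mem_ofPred_eq ▸ hω) with h | h
  · exact Or.inl h.le
  · exact Or.inr h.le

end Tail

/-! ### The second-order remainder of one document. -/

/-- The degenerate part of the second-order statistic of a single multinomial vector. -/
noncomputable def quadRemainder (N : ℕ) (q : Fin p → ℝ) (j l : Fin p) (y : Fin p → ℕ) : ℝ :=
  (N : ℝ) / ((N : ℝ) - 1) * ((y j / N : ℝ) * (y l / N : ℝ))
    - (if j = l then ((N : ℝ) - 1)⁻¹ * (y j / N : ℝ) else 0) - q j * q l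
    - q j * ((y l / N : ℝ) - q l) - q l * ((y j / N : ℝ) - q j)

/-- The Bernstein radius of a single relative frequency. -/
noncomputable def devRadius (N : ℕ) (L x : ℝ) : ℝ := √(6 * x * L / N) + L / N

open Classical in
/-- The remainder, set to zero off the event that both frequencies are within their radii. -/
noncomputable def truncRemainder (N : ℕ) (L : ℝ) (q : Fin p → ℝ) (j l : Fin p) (y : Fin p → ℕ) : ℝ :=
  if |(y j / N : ℝ) - q j| ≤ devRadius N L (q j) ∧ |(y l / N : ℝ) - q l| ≤ devRadius N L (q l)
  then quadRemainder N q j l y else 0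

/-- The factor `N / (N - 1)` and the diagonal correction make the quadratic term unbiased for `q j *
q l`, and the subtracted linear terms are centred. -/
theorem sum_multinomialProb_mul_quadRemainder {N : ℕ} {q : Fin p → ℝ} (hq : ∑ j, q j = 1)
    (hN : 2 ≤ N) (j l : Fin p) :
    ∑ y ∈ countVectors p N, multinomialProb N q y * quadRemainder N q j l y = 0 := by
  have h0 : ∑ y ∈ countVectors p N, multinomialProb N q y = 1 := by
    have := sum_multinomialProb_mul_exp N q 0
    simpa [hq] using this
  have h1 := sum_multinomialProb_mul_apply (N := N) hq j
  have h1' := sum_multinomialProb_mul_apply (N := N) hq l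
  have h2 := sum_multinomialProb_mul_apply_mul_apply hq (by omega : 1 ≤ N) j l
  have hN' : (2 : ℝ) ≤ N := by exact_mod_cast hN
  have hN0 : (N : ℝ) ≠ 0 := by linarith
  have hN1 : (N : ℝ) - 1 ≠ 0 := by linarith
  have key : ∀ y : Fin p → ℕ, multinomialProb N q y * quadRemainder N q j l y
      = ((N : ℝ) * (N - 1))⁻¹ * (multinomialProb N q y * ((y j : ℝ) * y l))
        - ((if j = l then ((N : ℝ) - 1)⁻¹ / N else 0) + q l / N) * (multinomialProb N q y * y j)
        - q j / N * (multinomialProb N q y * y l) + q j * q l * multinomialProb N q y := by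
    intro y
    unfold quadRemainder
    split_ifs <;> field_simp <;> ring
  simp_rw [key]
  rw [Finset.sum_add_distrib, Finset.sum_sub_distrib, Finset.sum_sub_distrib, ← Finset.mul_sum,
    ← Finset.mul_sum, ← Finset.mul_sum, ← Finset.mul_sum, h0, h1, h1', h2]
  split_ifs with h <;> field_simp <;> ring

/-- A crude sure bound, needed only to control the bias on the rare event that a frequency leaves
its radius. -/
theorem abs_quadRemainder_le_of_mem {N : ℕ} {q : Fin p → ℝ} (hq0 : ∀ j, 0 ≤ q j)
    (hq : ∑ j, q j = 1) (hN : 2 ≤ N) (j l : Fin p) {y : Fin p → ℕ} (hy : y ∈ countVectors p N) :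
    |quadRemainder N q j l y| ≤ 8 := by
  have hN' : (2 : ℝ) ≤ N := by exact_mod_cast hN
  have hq1 : ∀ j, q j ≤ 1 := fun j => by
    rw [← hq]; exact Finset.single_le_sum (fun b _ => hq0 b) (Finset.mem_univ j)
  have hy0 : ∀ j, 0 ≤ (y j / N : ℝ) := fun j => by positivity
  have hy1 : ∀ j, (y j / N : ℝ) ≤ 1 := fun j => by
    rw [div_le_one (by linarith)]
    have : y j ≤ ∑ b, y b := Finset.single_le_sum (fun b _ => Nat.zero_le _) (Finset.mem_univ j)
    rw [mem_countVectors.1 hy] at this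
    exact_mod_cast this
  have hx : ∀ j, |(y j / N : ℝ) - q j| ≤ 1 := fun j =>
    abs_le.2 ⟨by linarith [hy0 j, hq1 j], by linarith [hy1 j, hq0 j]⟩
  have hA : |(N : ℝ) / ((N : ℝ) - 1) * ((y j / N : ℝ) * (y l / N : ℝ))| ≤ 2 := by
    rw [abs_of_nonneg (mul_nonneg (div_nonneg (by linarith) (by linarith))
      (mul_nonneg (hy0 j) (hy0 l)))]
    have h1 : (N : ℝ) / (N - 1) ≤ 2 := by
      rw [div_le_iff₀ (by linarith)]; linarith
    have h2 : (y j / N : ℝ) * (y l / N : ℝ) ≤ 1 := mul_le_one₀ (hy1 j) (hy0 l) (hy1 l)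
    calc (N : ℝ) / ((N : ℝ) - 1) * ((y j / N : ℝ) * (y l / N : ℝ)) ≤ 2 * 1 :=
          mul_le_mul h1 h2 (mul_nonneg (hy0 j) (hy0 l)) (by norm_num)
      _ = 2 := by norm_num
  have hB : |if j = l then ((N : ℝ) - 1)⁻¹ * (y j / N : ℝ) else 0| ≤ 1 := by
    split_ifs
    · rw [abs_of_nonneg (mul_nonneg (inv_nonneg.2 (by linarith)) (hy0 j))]
      exact mul_le_one₀ (inv_le_one_of_one_le₀ (by linarith)) (hy0 j) (hy1 j)
    · simp
  have hC : |q j * q l| ≤ 1 := by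
    rw [abs_of_nonneg (mul_nonneg (hq0 j) (hq0 l))]
    exact mul_le_one₀ (hq1 j) (hq0 l) (hq1 l)
  have hD : ∀ j l, |q j * ((y l / N : ℝ) - q l)| ≤ 1 := fun j l => by
    rw [abs_mul, abs_of_nonneg (hq0 j)]
    exact mul_le_one₀ (hq1 j) (abs_nonneg _) (hx l)
  unfold quadRemainder
  rw [abs_le] at hA hB hC ⊢
  have hD1 := abs_le.1 (hD j l)
  have hD2 := abs_le.1 (hD l j)
  constructor <;> linarith [hA.1, hA.2, hB.1, hB.2, hC.1, hC.2, hD1.1, hD1.2, hD2.1, hD2.2]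

theorem devRadius_pos {N : ℕ} {L x : ℝ} (hN : 0 < (N : ℝ)) (hL : 0 < L) : 0 < devRadius N L x := by
  unfold devRadius; positivity

/-- The square-root term alone contributes `6 x L / N`, and `6 * (11 / 2) = 33`. -/
theorem div_le_devRadius_sq {N : ℕ} {L x : ℝ} (hN : 0 < (N : ℝ)) (hL : 11 / 2 ≤ L) (hx : 0 ≤ x) :
    33 * (x / N) ≤ devRadius N L x ^ 2 := by
  have h1 : √(6 * x * L / N) ^ 2 = 6 * x * L / N := Real.sq_sqrt (by positivity)
  have h2 : √(6 * x * L / N) ≤ devRadius N L x := by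
    unfold devRadius
    have : 0 ≤ L / N := by positivity
    linarith
  have h3 := pow_le_pow_left₀ (Real.sqrt_nonneg _) h2 2
  rw [h1] at h3
  refine le_trans ?_ h3
  rw [← mul_div_assoc]
  exact div_le_div_of_nonneg_right (by nlinarith) hN.le

/-- The remainder is of the order of the product of the two deviations. -/
theorem abs_quadRemainder_le {N : ℕ} {L : ℝ} {q : Fin p → ℝ} (hq0 : ∀ j, 0 ≤ q j)
    (hq : ∑ j, q j = 1) (hN : 200 ≤ (N : ℝ)) (hL : 11 / 2 ≤ L) (j l : Fin p) {y : Fin p → ℕ}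
    (hj : |(y j / N : ℝ) - q j| ≤ devRadius N L (q j))
    (hl : |(y l / N : ℝ) - q l| ≤ devRadius N L (q l)) :
    |quadRemainder N q j l y| ≤ 7 / 5 * (devRadius N L (q j) * devRadius N L (q l)) := by
  have hq1 : ∀ j, q j ≤ 1 := fun j => by
    rw [← hq]; exact Finset.single_le_sum (fun b _ => hq0 b) (Finset.mem_univ j)
  have hNpos : (0 : ℝ) < N := by linarith
  have hN1 : (0 : ℝ) < (N : ℝ) - 1 := by linarith
  have hD : ((N : ℝ) - 1)⁻¹ ≤ 101 / 100 * (1 / N) := by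
    rw [inv_eq_one_div, ← mul_div_assoc, div_le_div_iff₀ hN1 hNpos]; linarith
  have hD0 : 0 ≤ ((N : ℝ) - 1)⁻¹ := inv_nonneg.2 hN1.le
  -- For `x ≤ 1` and `N ≥ 200`, `(x / N)² ≤ (x / N) / 200`, which is at most the squared radius over
  -- `6600 ≥ 50²`.
  have hsmall : ∀ x, 0 ≤ x → x ≤ 1 → x / N ≤ devRadius N L x / 50 := by
    intro x hx0 hx1
    have h1 := div_le_devRadius_sq hNpos hL hx0
    have hT := devRadius_pos (x := x) hNpos (by linarith : 0 < L)
    refine abs_le_of_sq_le_sq' ?_ (by positivity) |>.2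
    have h2 : (x / N) ^ 2 ≤ x / N * (1 / 200) := by
      rw [sq]
      refine mul_le_mul_of_nonneg_left ?_ (by positivity)
      rw [div_le_div_iff₀ hNpos (by norm_num)]
      nlinarith
    nlinarith
  set a := q j
  set b := q l
  set S := devRadius N L a with hS
  set T := devRadius N L b with hT
  have hS0 : 0 < S := devRadius_pos hNpos (by linarith)
  have hT0 : 0 < T := devRadius_pos hNpos (by linarith)
  set e := (y j / N : ℝ) - a with he
  set f := (y l / N : ℝ) - b with hf
  -- In terms of the deviations `e` and `f` the leading term is `e * f`; everything else carries a
  -- factor `1 / (N - 1)`.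
  have hform : quadRemainder N q j l y = (1 + ((N : ℝ) - 1)⁻¹) * (e * f)
      + ((N : ℝ) - 1)⁻¹ * (a * b + a * f + b * e - if j = l then a + e else 0) := by
    have h1 : (y j / N : ℝ) = a + e := by rw [he]; ring
    have h2 : (y l / N : ℝ) = b + f := by rw [hf]; ring
    unfold quadRemainder
    rw [h1, h2]
    have : (N : ℝ) - 1 ≠ 0 := hN1.ne'
    change (N : ℝ) / ((N : ℝ) - 1) * ((a + e) * (b + f))
      - (if j = l then ((N : ℝ) - 1)⁻¹ * (a + e) else 0) - a * b - a * (b + f - b)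
      - b * (a + e - a) = _
    split_ifs <;> field_simp <;> ring
  have h_ef : |e * f| ≤ S * T := by
    rw [abs_mul]; exact mul_le_mul hj hl (abs_nonneg _) hS0.le
  have h_ab : a * b / N ≤ S * T / 33 := by
    refine abs_le_of_sq_le_sq' ?_ (by positivity) |>.2
    have h1 := div_le_devRadius_sq hNpos hL (hq0 j)
    have h2 := div_le_devRadius_sq hNpos hL (hq0 l)
    have h3 := mul_le_mul h1 h2 (by have := hq0 l; positivity) (by positivity)
    have h4 : (a * b / N) ^ 2 ≤ (a / N) * (b / N) := by
      have hab : a * b ≤ 1 := mul_le_one₀ (hq1 j) (hq0 l) (hq1 l)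
      have hab0 : 0 ≤ a * b := mul_nonneg (hq0 j) (hq0 l)
      calc (a * b / N) ^ 2 = (a * b) * (a * b) / (N * N) := by ring
        _ ≤ (a * b) * 1 / (N * N) := by gcongr
        _ = _ := by ring
    change 33 * (a / N) * (33 * (b / N)) ≤ S ^ 2 * T ^ 2 at h3
    calc (a * b / N) ^ 2 ≤ (a / N) * (b / N) := h4
      _ ≤ S ^ 2 * T ^ 2 / 33 ^ 2 := by
          rw [le_div_iff₀ (by norm_num)]; linarith
      _ = _ := by ring
  have h_af : |a * f / N| ≤ S * T / 50 := by
    rw [mul_div_right_comm, abs_mul, abs_of_nonneg (div_nonneg (hq0 j) hNpos.le)]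
    calc a / N * |f| ≤ S / 50 * T :=
          mul_le_mul (hsmall a (hq0 j) (hq1 j)) hl (abs_nonneg _) (by positivity)
      _ = _ := by ring
  have h_be : |b * e / N| ≤ S * T / 50 := by
    rw [mul_div_right_comm, abs_mul, abs_of_nonneg (div_nonneg (hq0 l) hNpos.le)]
    calc b / N * |e| ≤ T / 50 * S :=
          mul_le_mul (hsmall b (hq0 l) (hq1 l)) hj (abs_nonneg _) (by positivity)
      _ = _ := by ring
  -- On the diagonal the two radii coincide: `a / N` costs `1/33` of their product, and `|e| / N`
  -- costs `2/11` because `L / N ≤ S` and `L ≥ 11/2`.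
  have h_diag : |(if j = l then a + e else 0) / N| ≤ S * T * (1 / 33 + 2 / 11) := by
    split_ifs with h
    · have hST : T = S := by simp only [hS, hT, a, b, h]
      rw [hST]
      have h1 := div_le_devRadius_sq hNpos hL (hq0 j)
      change 33 * (a / N) ≤ S ^ 2 at h1
      have h2 : 1 / (N : ℝ) ≤ 2 / 11 * S := by
        have : L / N ≤ S := by
          rw [hS]; unfold devRadius
          linarith [Real.sqrt_nonneg (6 * a * L / N)]
        have h3 : (11 / 2) / (N : ℝ) ≤ L / N := by gcongr
        have h4 : 1 / (N : ℝ) = 2 / 11 * ((11 / 2) / (N : ℝ)) := by ring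
        rw [h4]; linarith
      have h3 : |e / N| ≤ S * (2 / 11 * S) := by
        rw [div_eq_mul_one_div, abs_mul, abs_of_nonneg (by positivity : 0 ≤ 1 / (N : ℝ))]
        exact mul_le_mul hj h2 (by positivity) hS0.le
      rw [add_div]
      refine (abs_add_le _ _).trans ?_
      rw [abs_of_nonneg (div_nonneg (hq0 j) hNpos.le)]
      linarith
    · simp only [zero_div, abs_zero]; positivity
  have h_br : |(a * b + a * f + b * e - if j = l then a + e else 0) / N| ≤ 29 / 100 * (S * T) := by
    have h0 : |a * b / N| ≤ S * T / 33 := by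
      rwa [abs_of_nonneg (div_nonneg (mul_nonneg (hq0 j) (hq0 l)) hNpos.le)]
    rw [sub_div, add_div, add_div]
    have hST : 0 < S * T := mul_pos hS0 hT0
    rw [abs_le] at *
    constructor <;> linarith [h0.1, h0.2, h_af.1, h_af.2, h_be.1, h_be.2, h_diag.1, h_diag.2]
  have hST : 0 < S * T := mul_pos hS0 hT0
  have hD' : ((N : ℝ) - 1)⁻¹ ≤ 1 / 100 := by
    refine hD.trans ?_
    have : 1 / (N : ℝ) ≤ 1 / 200 := one_div_le_one_div_of_le (by norm_num) hN
    linarith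
  rw [hform]
  refine (abs_add_le _ _).trans ?_
  rw [abs_mul, abs_mul (((N : ℝ) - 1)⁻¹), abs_of_nonneg (by linarith : 0 ≤ 1 + ((N : ℝ) - 1)⁻¹),
    abs_of_nonneg hD0]
  have h1 : (1 + ((N : ℝ) - 1)⁻¹) * |e * f| ≤ (1 + 1 / 100) * (S * T) := by gcongr
  have h2 : ((N : ℝ) - 1)⁻¹ * |a * b + a * f + b * e - if j = l then a + e else 0|
      ≤ 101 / 100 * (29 / 100 * (S * T)) := by
    calc ((N : ℝ) - 1)⁻¹ * |a * b + a * f + b * e - if j = l then a + e else 0|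
        ≤ 101 / 100 * (1 / N) * |a * b + a * f + b * e - if j = l then a + e else 0| := by gcongr
      _ = 101 / 100 * |(a * b + a * f + b * e - if j = l then a + e else 0) / N| := by
          rw [abs_div, abs_of_pos hNpos]; ring
      _ ≤ _ := by gcongr
  linarith

/-! ### Concentration of frequencies, row means, linear part and truncated remainder. -/

/-- The average of a row of a matrix. -/
noncomputable def rowMean (B : Matrix (Fin p) (Fin n) ℝ) (j : Fin p) : ℝ := (n : ℝ)⁻¹ * ∑ i, B j i

/-- The linear part of the error of the normalised second-order statistic. -/
noncomputable def linearPart (Pm X : Matrix (Fin p) (Fin n) ℝ) (j l : Fin p) : ℝ :=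
  (n : ℝ)⁻¹ * ∑ i, ((Pm j i - Theta Pm j l / rowMean Pm l) * (X l i - Pm l i)
    + (Pm l i - Theta Pm j l / rowMean Pm j) * (X j i - Pm j i))

theorem Theta_apply (Pm : Matrix (Fin p) (Fin n) ℝ) (j l : Fin p) :
    Theta Pm j l = (n : ℝ)⁻¹ * ∑ i, Pm j i * Pm l i := by
  simp [Theta, Matrix.mul_apply]

theorem Theta_comm (Pm : Matrix (Fin p) (Fin n) ℝ) (j l : Fin p) :
    Theta Pm j l = Theta Pm l j := by
  simp_rw [Theta_apply, mul_comm]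

theorem le_rowSup (B : Matrix (Fin p) (Fin n) ℝ) (j : Fin p) (i : Fin n) : B j i ≤ ⨆ i, B j i :=
  le_ciSup (Set.finite_range _).bddAbove i

theorem ColumnsAreProbabilities.le_one {B : Matrix (Fin p) (Fin n) ℝ}
    (hB : ColumnsAreProbabilities B) (j : Fin p) (i : Fin n) : B j i ≤ 1 := by
  rw [← hB.2 i]; exact Finset.single_le_sum (fun b _ => hB.1 b i) (Finset.mem_univ j)

theorem Theta_nonneg {Pm : Matrix (Fin p) (Fin n) ℝ} (h : ColumnsAreProbabilities Pm)
    (j l : Fin p) : 0 ≤ Theta Pm j l := by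
  rw [Theta_apply]
  exact mul_nonneg (inv_nonneg.2 (Nat.cast_nonneg _))
    (Finset.sum_nonneg fun i _ => mul_nonneg (h.1 j i) (h.1 l i))

theorem rowSup_nonneg {Pm : Matrix (Fin p) (Fin n) ℝ} (h : ColumnsAreProbabilities Pm)
    (j : Fin p) : 0 ≤ ⨆ i, Pm j i := Real.iSup_nonneg fun i => h.1 j i

theorem Theta_le {Pm : Matrix (Fin p) (Fin n) ℝ} (h : ColumnsAreProbabilities Pm)
    (j l : Fin p) : Theta Pm j l ≤ (⨆ i, Pm j i) * rowMean Pm l := by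
  rw [Theta_apply, rowMean, mul_left_comm, Finset.mul_sum _ _ (⨆ i, Pm j i)]
  exact mul_le_mul_of_nonneg_left (Finset.sum_le_sum fun i _ =>
    mul_le_mul_of_nonneg_right (le_rowSup Pm j i) (h.1 l i)) (inv_nonneg.2 (Nat.cast_nonneg _))

theorem freq_apply {Ω : Type*} {N : ℕ} {Y : Fin n → Ω → (Fin p → ℕ)} (ω : Ω) (j : Fin p) (i : Fin n) : freq N Y ω j i = (Y i ω j : ℝ) / N := rfl

theorem sum_mul_freq_sub {Ω : Type*} {N : ℕ} {Pm : Matrix (Fin p) (Fin n) ℝ}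
    {Y : Fin n → Ω → (Fin p → ℕ)} (hN : 0 < (N : ℝ)) (c : Fin p → Fin n → ℝ) (ω : Ω) :
    ∑ i, ∑ j, (c j i / N) * ((Y i ω j : ℝ) - N * Pm j i)
      = ∑ i, ∑ j, c j i * (freq N Y ω j i - Pm j i) := by
  refine Finset.sum_congr rfl fun i _ => Finset.sum_congr rfl fun j _ => ?_
  rw [freq_apply]
  field_simp

section Tail

variable {Ω : Type*} [MeasurableSpace Ω] {P : Measure Ω} [IsProbabilityMeasure P] {N : ℕ}
  {Pm : Matrix (Fin p) (Fin n) ℝ} {Y : Fin n → Ω → (Fin p → ℕ)} {L : ℝ}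

/-- Bernstein's inequality for linear functionals of the relative frequencies. -/
theorem bernstein_freq (hY : IsMultinomialSample P N Pm Y) (hPm : ColumnsAreProbabilities Pm)
    (hN : 0 < (N : ℝ)) {c : Fin p → Fin n → ℝ} {b V t : ℝ} (hb : 0 < b)
    (hc : ∀ j i, |c j i| ≤ b) (hV : ∑ i, ∑ j, Pm j i * c j i ^ 2 ≤ V) (ht : 0 < t) :
    P.real {ω | √(2 * (V / N) * t) + b / N / 3 * t
        < |∑ i, ∑ j, c j i * (freq N Y ω j i - Pm j i)|} ≤ 2 * Real.exp (-t) := by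
  have h := bernstein_multinomial_abs hY hPm (c := fun j i => c j i / N) (b := b / N) (V := V / N)
    (t := t) (by positivity) (fun j i => by
      rw [abs_div, abs_of_pos hN]; exact div_le_div_of_nonneg_right (hc j i) hN.le) ?_ ht
  · simp_rw [sum_mul_freq_sub hN] at h
    exact h
  · have : ∑ i, ∑ j, Pm j i * (c j i / N) ^ 2 = (∑ i, ∑ j, Pm j i * c j i ^ 2) / N ^ 2 := by
      simp_rw [Finset.sum_div]
      exact Finset.sum_congr rfl fun i _ => Finset.sum_congr rfl fun j _ => by ring
    rw [this]
    calc (N : ℝ) * ((∑ i, ∑ j, Pm j i * c j i ^ 2) / N ^ 2)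
        = (∑ i, ∑ j, Pm j i * c j i ^ 2) / N := by field_simp
      _ ≤ V / N := by gcongr

/-- Bernstein with an indicator coefficient and `t = 3 * L`, which produces exactly `devRadius`. The
rate `M⁻³` pays for a union over all pairs of a word and a document. -/
theorem tail_freq (hY : IsMultinomialSample P N Pm Y) (hPm : ColumnsAreProbabilities Pm)
    (hN : 0 < (N : ℝ)) (hL : 0 < L) (j : Fin p) (i : Fin n) :
    P.real {ω | devRadius N L (Pm j i) < |freq N Y ω j i - Pm j i|} ≤ 2 * Real.exp (-(3 * L)) := by
  have h := bernstein_freq hY hPm hN (c := fun j' i' => if j' = j ∧ i' = i then 1 else 0) (b := 1)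
    (V := Pm j i) (t := 3 * L) one_pos (fun j' i' => by split_ifs <;> simp) (by simp [ite_and])
    (by positivity)
  convert h using 5 with ω
  · unfold devRadius
    congr 2 <;> ring
  · simp [ite_and]

/-- Here `t = 2 * L` suffices, since the union runs over words only. -/
theorem tail_rowMean (hY : IsMultinomialSample P N Pm Y) (hPm : ColumnsAreProbabilities Pm)
    (hn : 0 < (n : ℝ)) (hN : 0 < (N : ℝ)) (hL : 0 < L) (j : Fin p) :
    P.real {ω | √(4 * rowMean Pm j * (L / (n * N))) + 2 / 3 * (L / (n * N))
      < |rowMean (freq N Y ω) j - rowMean Pm j|} ≤ 2 * Real.exp (-(2 * L)) := by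
  have h := bernstein_freq hY hPm hN (c := fun j' _ => if j' = j then (n : ℝ)⁻¹ else 0)
    (b := (n : ℝ)⁻¹) (V := rowMean Pm j / n) (t := 2 * L) (by positivity) (fun j' i' => by
      split_ifs
      · rw [abs_of_pos (by positivity)]
      · simp) (by
      simp [rowMean, Finset.mul_sum, Finset.sum_div]
      refine le_of_eq (Finset.sum_congr rfl fun i _ => by ring)) (by positivity)
  convert h using 5 with ω
  · congr 1
    · congr 1; field_simp; ring
    · field_simp
  · simp [rowMean, ← Finset.mul_sum, mul_sub]

/-- Centring can only help: expanding the square, the terms in `α = Θ / rowMean` add up to `-α Θ ≤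
0`. In what remains, one factor `Pm j i` is bounded by its maximum. -/
theorem linearPart_variance_le (hPm : ColumnsAreProbabilities Pm) {j l : Fin p}
    (hl : 0 < rowMean Pm l) :
    (n : ℝ)⁻¹ * ∑ i, Pm l i * (Pm j i - Theta Pm j l / rowMean Pm l) ^ 2
      ≤ (⨆ i, Pm j i) * Theta Pm j l := by
  set α := Theta Pm j l / rowMean Pm l with hα
  have hΘ := Theta_nonneg hPm j l
  have h1 : (n : ℝ)⁻¹ * ∑ i, Pm l i * (Pm j i - α) ^ 2
      = (n : ℝ)⁻¹ * ∑ i, Pm j i * (Pm j i * Pm l i) - 2 * α * Theta Pm j l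
        + α ^ 2 * rowMean Pm l := by
    rw [Theta_apply, rowMean]
    have : ∑ i, Pm l i * (Pm j i - α) ^ 2 = ∑ i, Pm j i * (Pm j i * Pm l i)
        - 2 * α * ∑ i, Pm j i * Pm l i + α ^ 2 * ∑ i, Pm l i := by
      rw [Finset.mul_sum, Finset.mul_sum, ← Finset.sum_sub_distrib, ← Finset.sum_add_distrib]
      exact Finset.sum_congr rfl fun i _ => by ring
    rw [this]; ring
  have h2 : α ^ 2 * rowMean Pm l = α * Theta Pm j l := by
    rw [hα]; field_simp
  have h3 : (n : ℝ)⁻¹ * ∑ i, Pm j i * (Pm j i * Pm l i) ≤ (⨆ i, Pm j i) * Theta Pm j l := by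
    rw [Theta_apply, mul_left_comm, Finset.mul_sum _ _ (⨆ i, Pm j i)]
    exact mul_le_mul_of_nonneg_left (Finset.sum_le_sum fun i _ =>
      mul_le_mul_of_nonneg_right (le_rowSup Pm j i) (mul_nonneg (hPm.1 j i) (hPm.1 l i)))
      (inv_nonneg.2 (Nat.cast_nonneg _))
  have h4 : 0 ≤ α * Theta Pm j l := mul_nonneg (div_nonneg hΘ hl.le) hΘ
  rw [h1, h2]
  linarith

/-- The quotient is the average of `Pm j ·` with weights proportional to `Pm l ·`, so both numbers
lie between `0` and the maximum of row `j`. -/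
theorem abs_sub_Theta_div_le (hPm : ColumnsAreProbabilities Pm) {j l : Fin p}
    (hl : 0 < rowMean Pm l) (i : Fin n) :
    |Pm j i - Theta Pm j l / rowMean Pm l| ≤ ⨆ i, Pm j i := by
  have h1 : Theta Pm j l / rowMean Pm l ≤ ⨆ i, Pm j i := by
    rw [div_le_iff₀ hl]; exact Theta_le hPm j l
  have h2 : 0 ≤ Theta Pm j l / rowMean Pm l := div_nonneg (Theta_nonneg hPm j l) hl.le
  exact abs_le.2 ⟨by linarith [hPm.1 j i], by linarith [le_rowSup Pm j i]⟩

/-- Bernstein with `t = 3 * L`. The variance proxy uses `(√m_j + √m_l)²` because it dominates `m_j +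
m_l` off the diagonal and equals the exact factor `4 m_j` on it. -/
theorem tail_linearPart (hY : IsMultinomialSample P N Pm Y) (hPm : ColumnsAreProbabilities Pm)
    (hn : 0 < (n : ℝ)) (hN : 0 < (N : ℝ)) (hL : 0 < L) {j l : Fin p}
    (hj : 0 < rowMean Pm j) (hl : 0 < rowMean Pm l) (hjs : 0 < ⨆ i, Pm j i) :
    P.real {ω | √6 * ((√(⨆ i, Pm j i) + √(⨆ i, Pm l i)) * √(Theta Pm j l * L / (n * N)))
        + ((⨆ i, Pm j i) + ⨆ i, Pm l i) * (L / (n * N)) < |linearPart Pm (freq N Y ω) j l|}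
      ≤ 2 * Real.exp (-(3 * L)) := by
  set mj := ⨆ i, Pm j i with hmj
  set ml := ⨆ i, Pm l i with hml
  have hml0 : 0 ≤ ml := rowSup_nonneg hPm l
  set α := Theta Pm j l / rowMean Pm l with hα
  set β := Theta Pm j l / rowMean Pm j with hβ
  have hΘ := Theta_nonneg hPm j l
  have hα_le : ∀ i, |Pm j i - α| ≤ mj := abs_sub_Theta_div_le hPm hl
  have hβ_le : ∀ i, |Pm l i - β| ≤ ml := fun i => by
    have := abs_sub_Theta_div_le (j := l) hPm hj i
    rwa [Theta_comm] at this
  have hVα : (n : ℝ)⁻¹ * ∑ i, Pm l i * (Pm j i - α) ^ 2 ≤ mj * Theta Pm j l :=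
    linearPart_variance_le hPm hl
  have hVβ : (n : ℝ)⁻¹ * ∑ i, Pm j i * (Pm l i - β) ^ 2 ≤ ml * Theta Pm j l := by
    have := linearPart_variance_le (j := l) hPm hj
    rwa [Theta_comm] at this
  have hsq : mj + ml ≤ (√mj + √ml) ^ 2 := by
    have h1 := Real.sq_sqrt hjs.le
    have h2 := Real.sq_sqrt hml0
    nlinarith [Real.sqrt_nonneg mj, Real.sqrt_nonneg ml, mul_nonneg (Real.sqrt_nonneg mj)
      (Real.sqrt_nonneg ml)]
  have h := bernstein_freq hY hPm hN
    (c := fun x i => (n : ℝ)⁻¹ * ((if x = l then Pm j i - α else 0)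
      + if x = j then Pm l i - β else 0)) (b := (mj + ml) / n)
    (V := (√mj + √ml) ^ 2 * Theta Pm j l / n) (t := 3 * L) (by positivity) (fun x i => by
      rw [abs_mul, abs_of_pos (by positivity), div_eq_inv_mul]
      refine mul_le_mul_of_nonneg_left ((abs_add_le _ _).trans (add_le_add ?_ ?_)) (by positivity)
      · split_ifs
        · exact hα_le i
        · simpa using hjs.le
      · split_ifs
        · exact hβ_le i
        · simpa using hml0) ?_ (by positivity)
  · convert h using 5 with ω
    · congr 1
      · have : 2 * ((√mj + √ml) ^ 2 * Theta Pm j l / n / N) * (3 * L)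
            = 6 * ((√mj + √ml) ^ 2 * (Theta Pm j l * L / (n * N))) := by field_simp; ring
        rw [this, Real.sqrt_mul (by norm_num), Real.sqrt_mul (by positivity),
          Real.sqrt_sq (by positivity)]
      · field_simp
    · rw [linearPart, Finset.mul_sum]
      refine congrArg _ ?_
      refine Finset.sum_congr rfl fun i _ => ?_
      simp only [mul_assoc, add_mul, Finset.sum_add_distrib, ← Finset.mul_sum, ite_mul, zero_mul,
        Finset.sum_ite_eq', Finset.mem_univ, if_true]
      rfl
  · have hfac : ∀ c : Fin p → Fin n → ℝ, ∑ i, ∑ x, Pm x i * ((n : ℝ)⁻¹ * c x i) ^ 2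
        = ((n : ℝ)⁻¹ * ∑ i, ∑ x, Pm x i * c x i ^ 2) / n := by
      intro c
      simp_rw [Finset.mul_sum, Finset.sum_div]
      exact Finset.sum_congr rfl fun i _ => Finset.sum_congr rfl fun x _ => by field_simp
    rw [hfac fun x i => (if x = l then Pm j i - α else 0) + if x = j then Pm l i - β else 0]
    refine div_le_div_of_nonneg_right ?_ hn.le
    -- For `j = l` both coefficients fall on the same word and add before squaring.
    by_cases hjl : j = l
    · subst hjl
      have hαβ : α = β := rfl
      have : ∀ i x, Pm x i * ((if x = j then Pm j i - α else 0)
          + if x = j then Pm j i - β else 0) ^ 2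
          = if x = j then 4 * (Pm j i * (Pm j i - α) ^ 2) else 0 := by
        intro i x
        rw [← hαβ]
        split_ifs with hx
        · subst hx; ring
        · ring
      simp_rw [this]
      simp only [Finset.sum_ite_eq', Finset.mem_univ, if_true, ← Finset.mul_sum]
      have hs := Real.sq_sqrt hjs.le
      have : (√mj + √ml) ^ 2 = 4 * mj := by
        change (√mj + √mj) ^ 2 = 4 * mj
        linear_combination 4 * hs
      rw [this]
      linarith
    · have : ∀ i x, Pm x i * ((if x = l then Pm j i - α else 0)
          + if x = j then Pm l i - β else 0) ^ 2
          = (if x = l then Pm l i * (Pm j i - α) ^ 2 else 0)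
            + if x = j then Pm j i * (Pm l i - β) ^ 2 else 0 := by
        intro i x
        by_cases hx : x = l
        · subst hx
          simp [show ¬ x = j from fun h => hjl h.symm]
        · by_cases hx' : x = j
          · subst hx'; simp [hx]
          · simp [hx, hx']
      simp_rw [this, Finset.sum_add_distrib]
      simp only [Finset.sum_ite_eq', Finset.mem_univ, if_true, mul_add]
      calc _ ≤ mj * Theta Pm j l + ml * Theta Pm j l := add_le_add hVα hVβ
        _ = (mj + ml) * Theta Pm j l := by ring
        _ ≤ _ := by gcongr

/-- Hoeffding's inequality for independent bounded variables with small bias. -/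
theorem hoeffding_abs {Z : Fin n → Ω → ℝ} (hind : iIndepFun Z P) (hmeas : ∀ i, Measurable (Z i))
    {b : Fin n → ℝ} {t d : ℝ} (hb0 : ∀ i, 0 ≤ b i) (hb : ∀ i ω, |Z i ω| ≤ b i) (ht : 0 ≤ t)
    (hbpos : 0 < ∑ i, b i ^ 2)
    (hd : ∀ i, |∫ ω, Z i ω ∂P| ≤ d) :
    P.real {ω | √(2 * t * ∑ i, b i ^ 2) + n * d < |∑ i, Z i ω|} ≤ 2 * Real.exp (-t) := by
  have hsub : ∀ i, HasSubgaussianMGF (fun ω => Z i ω - ∫ ω, Z i ω ∂P) (Real.toNNReal (b i) ^ 2) P := by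
    intro i
    have := hasSubgaussianMGF_of_mem_Icc (μ := P) (X := Z i) (a := - b i) (b := b i) (hmeas i).aemeasurable
      (Filter.Eventually.of_forall fun ω => abs_le.1 (hb i ω))
    convert this using 2
    ext
    rw [Real.coe_toNNReal _ (hb0 i)]
    simp only [NNReal.coe_div, coe_nnnorm, Real.norm_eq_abs]
    rw [abs_of_nonneg (by linarith [hb0 i])]
    simp
  have hind' : iIndepFun (fun i ω => Z i ω - ∫ ω, Z i ω ∂P) P :=
    hind.comp (fun i x => x - ∫ ω, Z i ω ∂P) fun i => measurable_id.sub_const _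
  have hsum := HasSubgaussianMGF.sum_of_iIndepFun hind' (s := Finset.univ) fun i _ => hsub i
  have hcoe : ((∑ i, Real.toNNReal (b i) ^ 2 : NNReal) : ℝ) = ∑ i, b i ^ 2 := by
    push_cast
    exact Finset.sum_congr rfl fun i _ => by rw [Real.coe_toNNReal _ (hb0 i)]
  have hexp : -√(2 * t * ∑ i, b i ^ 2) ^ 2 / (2 * ((∑ i, Real.toNNReal (b i) ^ 2 : NNReal) : ℝ))
      = -t := by
    rw [hcoe, Real.sq_sqrt (by positivity)]
    field_simp
  have h1 := hsum.measure_ge_le (ε := √(2 * t * ∑ i, b i ^ 2)) (Real.sqrt_nonneg _)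
  have h2 := hsum.neg.measure_ge_le (ε := √(2 * t * ∑ i, b i ^ 2)) (Real.sqrt_nonneg _)
  rw [hexp] at h1 h2
  refine (measureReal_mono ?_).trans ((measureReal_union_le _ _).trans
    ((add_le_add h1 h2).trans (le_of_eq (by ring))))
  intro ω hω
  have hbias : |∑ i, ∫ ω, Z i ω ∂P| ≤ n * d := by
    refine (Finset.abs_sum_le_sum_abs _ _).trans ((Finset.sum_le_sum fun i _ => hd i).trans ?_)
    simp
  have hω' : √(2 * t * ∑ i, b i ^ 2) + n * d < |∑ i, Z i ω| := hω
  have hb' := abs_le.1 hbias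
  rcases lt_abs.1 hω' with h | h
  · refine Or.inl ?_
    change _ ≤ ∑ i, (Z i ω - ∫ ω, Z i ω ∂P)
    rw [Finset.sum_sub_distrib]
    linarith
  · refine Or.inr ?_
    change _ ≤ - ∑ i, (Z i ω - ∫ ω, Z i ω ∂P)
    rw [Finset.sum_sub_distrib]
    linarith

/-- The untruncated remainder has mean zero, so the bias comes only from the two tail events: `8 *
(2 + 2) = 32`. -/
theorem abs_integral_truncRemainder_le (hY : IsMultinomialSample P N Pm Y)
    (hPm : ColumnsAreProbabilities Pm) (hN : 2 ≤ N) (hL : 0 < L) (j l : Fin p) (i : Fin n) :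
    |∫ ω, truncRemainder N L (fun x => Pm x i) j l (Y i ω) ∂P| ≤ 32 * Real.exp (-(3 * L)) := by
  classical
  have hNpos : 0 < (N : ℝ) := by exact_mod_cast (by omega : 0 < N)
  set q : Fin p → ℝ := fun x => Pm x i with hq
  have hq0 : ∀ j, 0 ≤ q j := fun j => hPm.1 j i
  have hq1 : ∑ j, q j = 1 := hPm.2 i
  set B : Fin p → Set Ω := fun j => {ω | devRadius N L (Pm j i) < |freq N Y ω j i - Pm j i|} with hB
  have hBm : ∀ j, MeasurableSet (B j) := fun j => by
    have : Measurable fun ω => |freq N Y ω j i - Pm j i| :=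
      (measurable_of_countable fun y : Fin p → ℕ => |(y j : ℝ) / N - Pm j i|).comp (hY.measurable i)
    exact measurableSet_lt measurable_const this
  have hint := integrable_comp_multinomial (hY.measurable i) (hY.law i)
  have hzero : ∫ ω, quadRemainder N q j l (Y i ω) ∂P = 0 := by
    rw [integral_comp_multinomial (hY.measurable i) (hY.law i) (quadRemainder N q j l)]
    exact sum_multinomialProb_mul_quadRemainder hq1 hN j l
  have hdiff : ∫ ω, truncRemainder N L q j l (Y i ω) ∂P
      = ∫ ω, (truncRemainder N L q j l (Y i ω) - quadRemainder N q j l (Y i ω)) ∂P := by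
    rw [integral_sub (hint _) (hint _), hzero, sub_zero]
  have hbound : ∀ᵐ ω ∂P, ‖truncRemainder N L q j l (Y i ω) - quadRemainder N q j l (Y i ω)‖
      ≤ (B j ∪ B l).indicator (fun _ => (8 : ℝ)) ω := by
    filter_upwards [ae_mem_countVectors (hY.law i)] with ω hω
    rw [Real.norm_eq_abs]
    by_cases h : ω ∈ B j ∪ B l
    · rw [Set.indicator_of_mem h]
      have h8 := abs_quadRemainder_le_of_mem hq0 hq1 hN j l hω
      unfold truncRemainder
      split_ifs
      · simp
      · simpa using h8
    · rw [Set.indicator_of_notMem h]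
      rw [Set.mem_union, not_or] at h
      have h1 : |((Y i ω j : ℝ) / N) - q j| ≤ devRadius N L (q j) := not_lt.1 h.1
      have h2 : |((Y i ω l : ℝ) / N) - q l| ≤ devRadius N L (q l) := not_lt.1 h.2
      rw [truncRemainder, if_pos ⟨h1, h2⟩]
      simp
  rw [hdiff, ← Real.norm_eq_abs]
  refine (norm_integral_le_of_norm_le ?_ hbound).trans ?_
  · exact (integrable_const _).indicator ((hBm j).union (hBm l))
  · rw [integral_indicator_const _ ((hBm j).union (hBm l)), smul_eq_mul]
    have h1 := tail_freq hY hPm hNpos hL j i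
    have h2 := tail_freq hY hPm hNpos hL l i
    have h3 := measureReal_union_le (μ := P) (B j) (B l)
    linarith

/-- The remainder is quadratic in the counts, so the linear Bernstein bound does not apply.
Truncation gives it a sure bound of the order of the product of the radii, at the price of a tiny
bias, and Hoeffding's inequality then applies across documents. -/
theorem tail_truncRemainder (hY : IsMultinomialSample P N Pm Y)
    (hPm : ColumnsAreProbabilities Pm) (hn : 0 < n) (hN : 200 ≤ (N : ℝ)) (hL : 11 / 2 ≤ L)
    (j l : Fin p) :
    P.real {ω | √(2 * (3 * L) * ∑ i, (7 / 5 * (devRadius N L (Pm j i) * devRadius N L (Pm l i))) ^ 2)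
        + n * (32 * Real.exp (-(3 * L)))
        < |∑ i, truncRemainder N L (fun x => Pm x i) j l (Y i ω)|} ≤ 2 * Real.exp (-(3 * L)) := by
  have hNpos : 0 < (N : ℝ) := by linarith
  have hLpos : 0 < L := by linarith
  have hdev : ∀ j i, 0 < devRadius N L (Pm j i) := fun j i => devRadius_pos hNpos hLpos
  have hb0 : ∀ i, 0 < 7 / 5 * (devRadius N L (Pm j i) * devRadius N L (Pm l i)) := fun i => by
    have := hdev j i
    have := hdev l i
    positivity
  have : Nonempty (Fin n) := ⟨⟨0, hn⟩⟩
  refine hoeffding_abs (Z := fun i ω => truncRemainder N L (fun x => Pm x i) j l (Y i ω))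
    (hY.indep.comp (fun i => truncRemainder N L (fun x => Pm x i) j l)
      fun i => measurable_of_countable _)
    (fun i => (measurable_of_countable (truncRemainder N L (fun x => Pm x i) j l)).comp
      (hY.measurable i)) (fun i => (hb0 i).le)
    (fun i ω => ?_) (by linarith)
    (Finset.sum_pos (fun i _ => pow_pos (hb0 i) 2) Finset.univ_nonempty)
    (abs_integral_truncRemainder_le hY hPm (by exact_mod_cast (by linarith : (2 : ℝ) ≤ N)) hLpos j l)
  rw [truncRemainder]
  split_ifs with h
  · exact abs_quadRemainder_le (fun x => hPm.1 x i) (hPm.2 i) hN hL j l h.1 h.2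
  · rw [abs_zero]; exact (hb0 i).le

end Tail

/-! ### The good event and its probability. -/

/-- The numerical consequences of the signal conditions, with `L = log M`. -/
structure StrongSignal (N : ℕ) (L : ℝ) (Pm : Matrix (Fin p) (Fin n) ℝ) : Prop where
  prob : ColumnsAreProbabilities Pm
  n_pos : 0 < n
  le_L : 11 / 2 ≤ L
  le_N : 200 ≤ (N : ℝ)
  N_le : (N : ℝ) ≤ Real.exp L
  n_le : (n : ℝ) ≤ Real.exp L
  p_lt : (p : ℝ) < Real.exp L
  mean_ge : ∀ j, 2 * L / (3 * N) ≤ rowMean Pm j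
  sup_ge : ∀ j, (3 * L) ^ 2 / N ≤ ⨆ i, Pm j i

/-- The scale of the linear part of the error. -/
noncomputable def linScale (N : ℕ) (L : ℝ) (Pm : Matrix (Fin p) (Fin n) ℝ) (j l : Fin p) : ℝ :=
  (√(⨆ i, Pm j i) + √(⨆ i, Pm l i)) * √(Theta Pm j l * L / (n * N))

/-- The scale of the degenerate part of the error. -/
noncomputable def quadScale (N : ℕ) (L : ℝ) (Pm : Matrix (Fin p) (Fin n) ℝ) (j l : Fin p) : ℝ :=
  √((rowMean Pm j + rowMean Pm l) * (L ^ 4 / (n * (N : ℝ) ^ 3)))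

/-- The event on which all error terms are controlled. -/
structure GoodEvent {Ω : Type*} (N : ℕ) (L : ℝ) (Pm : Matrix (Fin p) (Fin n) ℝ)
    (Y : Fin n → Ω → (Fin p → ℕ)) (ω : Ω) : Prop where
  freq_close : ∀ j i, |freq N Y ω j i - Pm j i| ≤ devRadius N L (Pm j i)
  rowMean_close : ∀ j, |rowMean (freq N Y ω) j - rowMean Pm j|
    ≤ √(4 * rowMean Pm j * (L / (n * N))) + 2 / 3 * (L / (n * N))
  linear_le : ∀ j l, |linearPart Pm (freq N Y ω) j l|
    ≤ √6 * linScale N L Pm j l + ((⨆ i, Pm j i) + ⨆ i, Pm l i) * (L / (n * N))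
  trunc_le : ∀ j l, |∑ i, truncRemainder N L (fun x => Pm x i) j l (Y i ω)|
    ≤ √(2 * (3 * L) * ∑ i, (7 / 5 * (devRadius N L (Pm j i) * devRadius N L (Pm l i))) ^ 2)
        + n * (32 * Real.exp (-(3 * L)))

section

variable {Ω : Type*} {N : ℕ} {Pm : Matrix (Fin p) (Fin n) ℝ} {Y : Fin n → Ω → (Fin p → ℕ)} {L : ℝ}

theorem StrongSignal.rowMean_pos (h : StrongSignal N L Pm) (j : Fin p) : 0 < rowMean Pm j := by
  have h1 := h.le_L
  have h2 := h.le_N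
  have : 0 < (N : ℝ) := by linarith
  exact lt_of_lt_of_le (by positivity) (h.mean_ge j)

theorem StrongSignal.rowSup_pos (h : StrongSignal N L Pm) (j : Fin p) : 0 < ⨆ i, Pm j i := by
  have h1 := h.le_L
  have h2 := h.le_N
  have : 0 < (N : ℝ) := by linarith
  exact lt_of_lt_of_le (by positivity) (h.sup_ge j)

/-- Union bound: `2 p n M⁻³ + 2 p M⁻² + 4 p² M⁻³`, which is below `8 M⁻¹` because `n ≤ M` and `p <
M`. -/
theorem measureReal_not_goodEvent_lt [MeasurableSpace Ω] {P : Measure Ω} [IsProbabilityMeasure P]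
    (hp : 0 < p) (h : StrongSignal N L Pm) (hY : IsMultinomialSample P N Pm Y) :
    P.real {ω | ¬ GoodEvent N L Pm Y ω} < 8 * Real.exp (-L) := by
  have hL : 0 < L := by linarith [h.le_L]
  have hN : 0 < (N : ℝ) := by linarith [h.le_N]
  have hn : 0 < (n : ℝ) := by exact_mod_cast h.n_pos
  set A := fun (j : Fin p) (i : Fin n) =>
    {ω | devRadius N L (Pm j i) < |freq N Y ω j i - Pm j i|} with hA
  set B := fun j : Fin p => {ω | √(4 * rowMean Pm j * (L / (n * N))) + 2 / 3 * (L / (n * N))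
      < |rowMean (freq N Y ω) j - rowMean Pm j|} with hB
  set C := fun j l : Fin p => {ω | √6 * linScale N L Pm j l
      + ((⨆ i, Pm j i) + ⨆ i, Pm l i) * (L / (n * N)) < |linearPart Pm (freq N Y ω) j l|} with hC
  set D := fun j l : Fin p =>
    {ω | √(2 * (3 * L) * ∑ i, (7 / 5 * (devRadius N L (Pm j i) * devRadius N L (Pm l i))) ^ 2)
        + n * (32 * Real.exp (-(3 * L)))
        < |∑ i, truncRemainder N L (fun x => Pm x i) j l (Y i ω)|} with hD
  have hsub : {ω | ¬ GoodEvent N L Pm Y ω}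
      ⊆ ((⋃ j, ⋃ i, A j i) ∪ ⋃ j, B j) ∪ ((⋃ j, ⋃ l, C j l) ∪ ⋃ j, ⋃ l, D j l) := by
    intro ω hω
    by_contra hc
    simp only [Set.mem_union, Set.mem_iUnion, not_or, not_exists] at hc
    exact hω ⟨fun j i => not_lt.1 (hc.1.1 j i), fun j => not_lt.1 (hc.1.2 j),
      fun j l => not_lt.1 (hc.2.1 j l), fun j l => not_lt.1 (hc.2.2 j l)⟩
  have hAle : P.real (⋃ j, ⋃ i, A j i) ≤ p * (n * (2 * Real.exp (-(3 * L)))) := by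
    refine (measureReal_iUnion_fintype_le _).trans ?_
    refine (Finset.sum_le_sum fun j _ => (measureReal_iUnion_fintype_le _).trans
      (Finset.sum_le_sum fun i _ => tail_freq hY h.prob hN hL j i)).trans (le_of_eq ?_)
    simp
  have hBle : P.real (⋃ j, B j) ≤ p * (2 * Real.exp (-(2 * L))) := by
    refine (measureReal_iUnion_fintype_le _).trans ?_
    refine (Finset.sum_le_sum fun j _ => tail_rowMean hY h.prob hn hN hL j).trans (le_of_eq ?_)
    simp
  have hCle : P.real (⋃ j, ⋃ l, C j l) ≤ p * (p * (2 * Real.exp (-(3 * L)))) := by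
    refine (measureReal_iUnion_fintype_le _).trans ?_
    refine (Finset.sum_le_sum fun j _ => (measureReal_iUnion_fintype_le _).trans
      (Finset.sum_le_sum fun l _ => tail_linearPart hY h.prob hn hN hL (h.rowMean_pos j)
        (h.rowMean_pos l) (h.rowSup_pos j))).trans (le_of_eq ?_)
    simp
  have hDle : P.real (⋃ j, ⋃ l, D j l) ≤ p * (p * (2 * Real.exp (-(3 * L)))) := by
    refine (measureReal_iUnion_fintype_le _).trans ?_
    refine (Finset.sum_le_sum fun j _ => (measureReal_iUnion_fintype_le _).trans
      (Finset.sum_le_sum fun l _ => tail_truncRemainder hY h.prob h.n_pos h.le_N h.le_L j l)).trans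
      (le_of_eq ?_)
    simp
  have htot : P.real {ω | ¬ GoodEvent N L Pm Y ω} ≤ (p * (n * (2 * Real.exp (-(3 * L))))
      + p * (2 * Real.exp (-(2 * L)))) + (p * (p * (2 * Real.exp (-(3 * L))))
      + p * (p * (2 * Real.exp (-(3 * L))))) :=
    (measureReal_mono hsub).trans ((measureReal_union_le _ _).trans (add_le_add
      ((measureReal_union_le _ _).trans (add_le_add hAle hBle))
      ((measureReal_union_le _ _).trans (add_le_add hCle hDle))))
  refine htot.trans_lt ?_
  set x := Real.exp (-L) with hx
  have hx0 : 0 < x := Real.exp_pos _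
  have hxL : Real.exp L * x = 1 := by rw [hx, ← Real.exp_add]; simp
  have h2 : Real.exp (-(2 * L)) = x ^ 2 := by
    rw [hx, ← Real.exp_nat_mul]; congr 1; push_cast; ring
  have h3 : Real.exp (-(3 * L)) = x ^ 3 := by
    rw [hx, ← Real.exp_nat_mul]; congr 1; push_cast; ring
  rw [h2, h3]
  have hpx : p * x < 1 := by rw [← hxL]; exact mul_lt_mul_of_pos_right h.p_lt hx0
  have hnx : n * x ≤ 1 := by rw [← hxL]; exact mul_le_mul_of_nonneg_right h.n_le hx0.le
  have hpx0 : 0 < p * x := mul_pos (by exact_mod_cast hp) hx0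
  have e1 : (p * x) * (n * x) ≤ p * x := mul_le_of_le_one_right hpx0.le hnx
  have e2 : (p * x) * (p * x) ≤ p * x := mul_le_of_le_one_right hpx0.le hpx.le
  have e3 : 2 * ((p * x) * (n * x)) + 2 * (p * x) + 4 * ((p * x) * (p * x)) < 8 := by linarith
  nlinarith [mul_lt_mul_of_pos_left e3 hx0]

/-! ### The degenerate part measured in the scales of `η`. -/

/-- The squared product of two radii. -/
theorem devRadius_mul_sq_le {a b : ℝ} (ha : 0 ≤ a) (hb : 0 ≤ b) (hL : 0 < L) (hN : 0 < (N : ℝ)) :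
    (devRadius N L a * devRadius N L b) ^ 2
      ≤ 50.4 * (L / N) ^ 2 * (a * b) + 54.6 * (L / N) ^ 3 * (a + b) + 91 / 6 * (L / N) ^ 4 := by
  unfold devRadius
  set u := L / (N : ℝ) with hu
  have hu0 : 0 < u := by positivity
  have hx : √(6 * a * L / N) ^ 2 = 6 * a * u := by
    rw [Real.sq_sqrt (by positivity), hu]; ring
  have hz : √(6 * b * L / N) ^ 2 = 6 * b * u := by
    rw [Real.sq_sqrt (by positivity), hu]; ring
  set x := √(6 * a * L / N)
  set z := √(6 * b * L / N)
  -- Weighted forms `(r + w)² ≤ (1 + ε) r² + (1 + 1/ε) w²` with `ε = 0.4` and, below, `ε = 0.3`. The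
  -- constants become `50.4 = 1.4 * 36`, `54.6 = 3.5 * 1.3 * 12` and `91/6 = 3.5 * 13/3`.
  have h1 : ∀ r w : ℝ, (r + w) ^ 2 ≤ 1.4 * r ^ 2 + 3.5 * w ^ 2 := fun r w => by
    nlinarith [sq_nonneg (2 * r - 5 * w)]
  have h2 : ∀ r w : ℝ, (r + w) ^ 2 ≤ 1.3 * r ^ 2 + 13 / 3 * w ^ 2 := fun r w => by
    nlinarith [sq_nonneg (3 * r - 10 * w)]
  have h3 : (x + z) ^ 2 ≤ 12 * u * (a + b) := by nlinarith [sq_nonneg (x - z)]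
  calc ((x + u) * (z + u)) ^ 2 = (x * z + (u * (x + z) + u ^ 2)) ^ 2 := by ring
    _ ≤ 1.4 * (x * z) ^ 2 + 3.5 * (u * (x + z) + u ^ 2) ^ 2 := h1 _ _
    _ ≤ 1.4 * (x ^ 2 * z ^ 2) + 3.5 * (1.3 * (u ^ 2 * (x + z) ^ 2) + 13 / 3 * (u ^ 2) ^ 2) := by
        have := h2 (u * (x + z)) (u ^ 2)
        rw [mul_pow u] at this
        rw [mul_pow x]
        linarith
    _ ≤ 1.4 * (x ^ 2 * z ^ 2) + 3.5 * (1.3 * (u ^ 2 * (12 * u * (a + b))) + 13 / 3 * (u ^ 2) ^ 2) := by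
        gcongr
    _ = _ := by rw [hx, hz]; ring

/-- The constants of `devRadius_mul_sq_le` are multiplied by `(7/5)²`. The fourth-order term is
absorbed into the third-order one, since the condition on the means gives `L / N ≤ 3/4 * (rowMean Pm
j + rowMean Pm l)`. -/
theorem sum_devRadius_mul_sq_le (h : StrongSignal N L Pm) (j l : Fin p) :
    ∑ i, (7 / 5 * (devRadius N L (Pm j i) * devRadius N L (Pm l i))) ^ 2
      ≤ n * (L / N) ^ 2 * (98.784 * Theta Pm j l
        + 129.32 * (L / N) * (rowMean Pm j + rowMean Pm l)) := by
  have hL : 0 < L := by linarith [h.le_L]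
  have hN : 0 < (N : ℝ) := by linarith [h.le_N]
  have hn : 0 < (n : ℝ) := by exact_mod_cast h.n_pos
  set u := L / (N : ℝ) with hu
  have hu0 : 0 < u := by positivity
  have hS : 4 / 3 * u ≤ rowMean Pm j + rowMean Pm l := by
    have e : 2 * L / (3 * N) = 2 / 3 * u := by rw [hu]; field_simp
    have h1 := h.mean_ge j
    have h2 := h.mean_ge l
    rw [e] at h1 h2
    linarith
  have hΘ : ∑ i, Pm j i * Pm l i = n * Theta Pm j l := by
    rw [Theta_apply]; field_simp
  have hm : ∀ j, ∑ i, Pm j i = n * rowMean Pm j := fun j => by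
    rw [rowMean]; field_simp
  calc ∑ i, (7 / 5 * (devRadius N L (Pm j i) * devRadius N L (Pm l i))) ^ 2
      ≤ ∑ i, (98.784 * u ^ 2 * (Pm j i * Pm l i) + 107.016 * u ^ 3 * (Pm j i + Pm l i)
          + 29.7267 * u ^ 4) := by
        refine Finset.sum_le_sum fun i _ => ?_
        have := devRadius_mul_sq_le (h.prob.1 j i) (h.prob.1 l i) hL hN
        rw [mul_pow]
        have hu4 : 0 < u ^ 4 := by positivity
        linarith
    _ = n * (98.784 * u ^ 2 * Theta Pm j l + 107.016 * u ^ 3 * (rowMean Pm j + rowMean Pm l)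
          + 29.7267 * u ^ 3 * u) := by
        rw [Finset.sum_add_distrib, Finset.sum_add_distrib, ← Finset.mul_sum, ← Finset.mul_sum,
          Finset.sum_add_distrib, hΘ, hm, hm]
        simp
        ring
    _ ≤ n * (98.784 * u ^ 2 * Theta Pm j l + 107.016 * u ^ 3 * (rowMean Pm j + rowMean Pm l)
          + 29.7267 * u ^ 3 * (3 / 4 * (rowMean Pm j + rowMean Pm l))) := by
        gcongr; linarith
    _ ≤ _ := by
        have : 0 < u ^ 3 * (rowMean Pm j + rowMean Pm l) := by
          have := h.rowMean_pos j
          have := h.rowMean_pos l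
          positivity
        have h4 : (n : ℝ) * (107.016 * (u ^ 3 * (rowMean Pm j + rowMean Pm l))
          + 29.7267 * (3 / 4) * (u ^ 3 * (rowMean Pm j + rowMean Pm l)))
          ≤ n * (129.32 * (u ^ 3 * (rowMean Pm j + rowMean Pm l))) := by
          gcongr; linarith
        nlinarith

/-- The condition on the maxima gives `√m_j ≥ 3 L / √N` for each word, and the two words give `6`.
This lets the leading term of the degenerate part be charged to the linear scale. -/
theorem sqrt_Theta_le_linScale (h : StrongSignal N L Pm) (j l : Fin p) :
    6 * √(Theta Pm j l * L ^ 3 / (n * (N : ℝ) ^ 2)) ≤ linScale N L Pm j l := by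
  have hL : 0 < L := by linarith [h.le_L]
  have hN : 0 < (N : ℝ) := by linarith [h.le_N]
  have hn : 0 < (n : ℝ) := by exact_mod_cast h.n_pos
  have hs : ∀ j, 3 * √(L ^ 2 / N) ≤ √(⨆ i, Pm j i) := fun j => by
    have := Real.sqrt_le_sqrt (h.sup_ge j)
    rwa [show (3 * L) ^ 2 / (N : ℝ) = 3 ^ 2 * (L ^ 2 / N) by ring, Real.sqrt_mul (by norm_num),
      Real.sqrt_sq (by norm_num)] at this
  have e : √(Theta Pm j l * L ^ 3 / (n * (N : ℝ) ^ 2))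
      = √(L ^ 2 / N) * √(Theta Pm j l * L / (n * N)) := by
    rw [← Real.sqrt_mul (by positivity)]
    congr 1
    field_simp
  rw [e, linScale, ← mul_assoc]
  refine mul_le_mul_of_nonneg_right ?_ (Real.sqrt_nonneg _)
  linarith [hs j, hs l]

/-- The factor `6 L` of Hoeffding's bound yields `6 * 98.784 ≤ 24.36²` and `6 * 129.32 ≤ 27.9²`;
then `24.36 / 6 = 4.06`. -/
theorem sqrt_sum_devRadius_le (h : StrongSignal N L Pm) (j l : Fin p) :
    √(2 * (3 * L) * ∑ i, (7 / 5 * (devRadius N L (Pm j i) * devRadius N L (Pm l i))) ^ 2) / n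
      ≤ 4.06 * linScale N L Pm j l + 27.9 * quadScale N L Pm j l := by
  have hL : 0 < L := by linarith [h.le_L]
  have hN : 0 < (N : ℝ) := by linarith [h.le_N]
  have hn : 0 < (n : ℝ) := by exact_mod_cast h.n_pos
  have hΘ := Theta_nonneg h.prob j l
  have hj := h.rowMean_pos j
  have hl := h.rowMean_pos l
  have h1 := sqrt_Theta_le_linScale h j l
  have h2 := sum_devRadius_mul_sq_le h j l
  set G := √(Theta Pm j l * L ^ 3 / (n * (N : ℝ) ^ 2)) with hG
  have hG2 : G ^ 2 = Theta Pm j l * L ^ 3 / (n * (N : ℝ) ^ 2) := Real.sq_sqrt (by positivity)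
  set V := quadScale N L Pm j l with hV
  have hV2 : V ^ 2 = (rowMean Pm j + rowMean Pm l) * (L ^ 4 / (n * (N : ℝ) ^ 3)) :=
    Real.sq_sqrt (by positivity)
  have hG0 : 0 ≤ G := Real.sqrt_nonneg _
  have hV0 : 0 ≤ V := Real.sqrt_nonneg _
  have key : √(2 * (3 * L) * ∑ i, (7 / 5 * (devRadius N L (Pm j i) * devRadius N L (Pm l i))) ^ 2)
      ≤ n * (24.36 * G + 27.9 * V) := by
    refine Real.sqrt_le_iff.2 ⟨by positivity, ?_⟩
    calc 2 * (3 * L) * ∑ i, (7 / 5 * (devRadius N L (Pm j i) * devRadius N L (Pm l i))) ^ 2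
        ≤ 2 * (3 * L) * (n * (L / N) ^ 2 * (98.784 * Theta Pm j l
        + 129.32 * (L / N) * (rowMean Pm j + rowMean Pm l))) := by gcongr
      _ = n ^ 2 * (592.704 * G ^ 2 + 775.92 * V ^ 2) := by
          rw [hG2, hV2]; field_simp; ring
      _ ≤ n ^ 2 * (24.36 * G + 27.9 * V) ^ 2 := by
          gcongr
          nlinarith [mul_nonneg hG0 hV0, sq_nonneg G, sq_nonneg V]
      _ = _ := by ring
  rw [div_le_iff₀ hn]
  refine key.trans ?_
  rw [mul_comm]
  exact mul_le_mul_of_nonneg_right (by linarith) hn.le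

/-- After squaring, the bias is of order `M⁻⁶`, while the scale is at least `4/3 * L⁵ / (n N⁴)` with
`n, N ≤ M` and `4/3 * (11/2)⁵ ≥ 1024`. -/
theorem bias_le_quadScale (h : StrongSignal N L Pm) (j l : Fin p) :
    32 * Real.exp (-(3 * L)) ≤ quadScale N L Pm j l := by
  have hL : 0 < L := by linarith [h.le_L]
  have hN : 0 < (N : ℝ) := by linarith [h.le_N]
  have hn : 0 < (n : ℝ) := by exact_mod_cast h.n_pos
  refine Real.le_sqrt_of_sq_le ?_
  set M := Real.exp L with hM
  have hM0 : 0 < M := Real.exp_pos L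
  have hM1 : 1 ≤ M := Real.one_le_exp hL.le
  have e : Real.exp (-(3 * L)) = (M ^ 3)⁻¹ := by
    rw [Real.exp_neg, hM, ← Real.exp_nat_mul]; congr 2
  have hS : 4 / 3 * (L / N) ≤ rowMean Pm j + rowMean Pm l := by
    have e : 2 * L / (3 * N) = 2 / 3 * (L / N) := by field_simp
    have h1 := h.mean_ge j
    have h2 := h.mean_ge l
    rw [e] at h1 h2
    linarith
  have hL5 : (11 / 2) ^ 5 ≤ L ^ 5 := pow_le_pow_left₀ (by norm_num) h.le_L 5
  calc (32 * Real.exp (-(3 * L))) ^ 2 = 1024 / M ^ 6 := by rw [e]; field_simp; norm_num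
    _ ≤ 1024 / M ^ 5 := by
        gcongr
        norm_num
    _ ≤ 4 / 3 * L ^ 5 / M ^ 5 := by
        gcongr
        norm_num at hL5
        linarith
    _ = 4 / 3 * L ^ 5 / (M * M ^ 4) := by ring
    _ ≤ 4 / 3 * L ^ 5 / (n * (N : ℝ) ^ 4) := by
        gcongr
        · exact h.n_le
        · exact h.N_le
    _ = 4 / 3 * (L / N) * (L ^ 4 / (n * (N : ℝ) ^ 3)) := by field_simp
    _ ≤ _ := by gcongr

/-- The average of the degenerate remainders. -/
noncomputable def quadMean (N : ℕ) (Pm : Matrix (Fin p) (Fin n) ℝ) (Y : Fin n → Ω → (Fin p → ℕ))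
    (ω : Ω) (j l : Fin p) : ℝ :=
  (n : ℝ)⁻¹ * ∑ i, quadRemainder N (fun x => Pm x i) j l (Y i ω)

/-- On the good event every frequency is within its radius, so the truncation is inactive and the
truncated bound applies. The bias raises `27.9` to `28.9`. -/
theorem GoodEvent.abs_quadMean_le {ω : Ω} (hg : GoodEvent N L Pm Y ω) (h : StrongSignal N L Pm)
    (j l : Fin p) :
    |quadMean N Pm Y ω j l| ≤ 4.06 * linScale N L Pm j l + 28.9 * quadScale N L Pm j l := by
  have hn : 0 < (n : ℝ) := by exact_mod_cast h.n_pos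
  have h1 : ∑ i, truncRemainder N L (fun x => Pm x i) j l (Y i ω)
      = ∑ i, quadRemainder N (fun x => Pm x i) j l (Y i ω) :=
    Finset.sum_congr rfl fun i _ => if_pos ⟨hg.freq_close j i, hg.freq_close l i⟩
  have h2 := hg.trunc_le j l
  rw [h1] at h2
  have h3 := sqrt_sum_devRadius_le h j l
  have h4 := bias_le_quadScale h j l
  rw [quadMean, abs_mul, abs_of_pos (inv_pos.2 hn), ← div_eq_inv_mul]
  calc _ ≤ (√(2 * (3 * L) * ∑ i, (7 / 5 * (devRadius N L (Pm j i) * devRadius N L (Pm l i))) ^ 2)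
        + n * (32 * Real.exp (-(3 * L)))) / n := by gcongr
    _ = √(2 * (3 * L) * ∑ i, (7 / 5 * (devRadius N L (Pm j i) * devRadius N L (Pm l i))) ^ 2) / n
        + 32 * Real.exp (-(3 * L)) := by field_simp
    _ ≤ _ := by linarith

/-- With at most two columns no concentration is needed for the degenerate part. -/
theorem GoodEvent.abs_quadMean_le_of_le_two {ω : Ω} (hg : GoodEvent N L Pm Y ω)
    (h : StrongSignal N L Pm) (hn2 : n ≤ 2) (j l : Fin p) :
    |quadMean N Pm Y ω j l| ≤ 1.1 * linScale N L Pm j l + 7 * quadScale N L Pm j l := by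
  have hn : 0 < (n : ℝ) := by exact_mod_cast h.n_pos
  have hn2' : (n : ℝ) ≤ 2 := by exact_mod_cast hn2
  have hL := h.le_L
  set b := fun i => 7 / 5 * (devRadius N L (Pm j i) * devRadius N L (Pm l i)) with hb
  have hB0 : 0 ≤ ∑ i, b i ^ 2 := Finset.sum_nonneg fun i _ => sq_nonneg _
  have h1 : |∑ i, quadRemainder N (fun x => Pm x i) j l (Y i ω)| ≤ ∑ i, b i :=
    (Finset.abs_sum_le_sum_abs _ _).trans (Finset.sum_le_sum fun i _ =>
      abs_quadRemainder_le (fun x => h.prob.1 x i) (h.prob.2 i) h.le_N h.le_L j l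
        (hg.freq_close j i) (hg.freq_close l i))
  have h2 : (∑ i, b i) ^ 2 ≤ n * ∑ i, b i ^ 2 := by
    have := sq_sum_le_card_mul_sum_sq (s := (Finset.univ : Finset (Fin n))) (f := b)
    simpa using this
  -- Cauchy–Schwarz over at most two columns costs a factor `2`, and `16 * 2 ≤ 33 ≤ 6 L`. The
  -- general constants are thus divided by `4`.
  have h3 : 4 * ∑ i, b i ≤ √(2 * (3 * L) * ∑ i, b i ^ 2) := by
    refine Real.le_sqrt_of_sq_le ?_
    nlinarith
  have h4 := sqrt_sum_devRadius_le h j l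
  change √(2 * (3 * L) * ∑ i, b i ^ 2) / n ≤ _ at h4
  have h5 : 4 * ((∑ i, b i) / n) ≤ √(2 * (3 * L) * ∑ i, b i ^ 2) / n := by
    rw [← mul_div_assoc]; gcongr
  have hU : 0 ≤ linScale N L Pm j l := by unfold linScale; positivity
  have hV : 0 ≤ quadScale N L Pm j l := Real.sqrt_nonneg _
  rw [quadMean, abs_mul, abs_of_pos (inv_pos.2 hn), ← div_eq_inv_mul]
  calc _ ≤ (∑ i, b i) / n := by gcongr
    _ ≤ _ := by linarith

end

/-! ### The factor `1 + κ₁ κ₃`. -/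

theorem kappa₁_nonneg (n : ℕ) : 0 ≤ kappa₁ n := Real.sqrt_nonneg _

theorem kappa₁_sq (n : ℕ) : kappa₁ n ^ 2 = 6 / n := Real.sq_sqrt (by positivity)

theorem kappa₃_nonneg (n : ℕ) : 0 ≤ kappa₃ n := by
  have := kappa₁_nonneg n
  unfold kappa₃; positivity

theorem kappa₁_mul_kappa₃ (n : ℕ) : kappa₁ n * kappa₃ n
    = 2 * (kappa₁ n + kappa₁ n ^ 2) / (1 - (kappa₁ n + kappa₁ n ^ 2)) ^ 2 := by
  unfold kappa₃
  rw [← sub_sub]; ring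

/-- Equality would mean `n² + 36 = 18 n`, which has no integer solution. It must be excluded because
the denominator of `κ₃` would vanish and division by zero would make `κ₃ = 0`. -/
theorem kappa₁_add_sq_ne_one (hn : 0 < n) : kappa₁ n + kappa₁ n ^ 2 ≠ 1 := by
  intro h
  have h2 := kappa₁_sq n
  have hn' : (n : ℝ) ≠ 0 := by positivity
  rw [h2] at h
  have h3 : kappa₁ n = 1 - 6 / n := by linarith
  rw [h3] at h2
  have h4 : (n : ℝ) ^ 2 + 36 = 18 * n := by
    field_simp at h2
    nlinarith
  have h5 : n ^ 2 + 36 = 18 * n := by exact_mod_cast h4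
  have : n ≤ 18 := by nlinarith
  interval_cases n <;> omega

theorem inv_sq_one_sub_le {z : ℝ} (hz : z ≤ 0.298) : ((1 - z) ^ 2)⁻¹ ≤ 2.05 := by
  rw [inv_le_comm₀ (by nlinarith) (by norm_num)]
  norm_num at hz ⊢
  nlinarith

/-- Put `y = κ₁ + κ₁²`. If `y < 1`, monotonicity and `(1 - y)⁻² = 1 + (2 y - y²) / (1 - y)²`
suffice. If `y > 1`, `κ₃` no longer reflects the size of `z`, but `κ₁² ≤ 2` keeps `κ₁ κ₃ ≥ 1.05`,
enough for the absolute bound `z ≤ 0.298`. -/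
theorem inv_sq_le_one_add_kappa (hn : 3 ≤ n) {z : ℝ}
    (hz : z ≤ kappa₁ n + kappa₁ n ^ 2 / 6) (hz' : z ≤ 0.298) :
    ((1 - z) ^ 2)⁻¹ ≤ 1 + kappa₁ n * kappa₃ n := by
  have hne := kappa₁_add_sq_ne_one (by omega : 0 < n)
  rw [kappa₁_mul_kappa₃]
  have h0 := kappa₁_nonneg n
  have hsq := kappa₁_sq n
  set x := kappa₁ n
  set y := x + x ^ 2 with hy
  have hzy : z ≤ y := by nlinarith [sq_nonneg x]
  have hz1 : 0 < 1 - z := by linarith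
  have hpos : 0 < (1 - y) ^ 2 := by
    have : 1 - y ≠ 0 := fun h => hne (by linarith)
    positivity
  rcases lt_or_gt_of_ne hne with hy1 | hy1
  · have h1 : 0 < 1 - y := by linarith
    have h2 : ((1 - z) ^ 2)⁻¹ ≤ ((1 - y) ^ 2)⁻¹ := by gcongr
    have h3 : ((1 - y) ^ 2)⁻¹ = 1 + (2 * y - y ^ 2) / (1 - y) ^ 2 := by
      field_simp; ring
    have h4 : (2 * y - y ^ 2) / (1 - y) ^ 2 ≤ 2 * y / (1 - y) ^ 2 := by
      gcongr; nlinarith [sq_nonneg y]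
    linarith
  · have h1 : ((1 - z) ^ 2)⁻¹ ≤ 2.05 := inv_sq_one_sub_le hz'
    have hn' : (3 : ℝ) ≤ n := by exact_mod_cast hn
    have hx2 : x ^ 2 ≤ 2 := by
      rw [hsq, div_le_iff₀ (by linarith)]; linarith
    have hx : x ≤ 1.42 := abs_le_of_sq_le_sq' (by linarith) (by norm_num) |>.2
    have h2 : 1.05 ≤ 2 * y / (1 - y) ^ 2 := by
      rw [le_div_iff₀ hpos]
      nlinarith
    linarith

/-- For one or two documents `1 + κ₁ κ₃` need not dominate `2.05`. This weaker bound is compensated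
by the smaller constants of `GoodEvent.abs_quadMean_le_of_le_two`. -/
theorem le_one_add_kappa (hn : 0 < n) (hn2 : n ≤ 2) : 1.2 ≤ 1 + kappa₁ n * kappa₃ n := by
  have hne := kappa₁_add_sq_ne_one hn
  rw [kappa₁_mul_kappa₃]
  have h0 := kappa₁_nonneg n
  have hsq := kappa₁_sq n
  set x := kappa₁ n
  set y := x + x ^ 2 with hy
  have hn' : (1 : ℝ) ≤ n := by exact_mod_cast hn
  have hn2' : (n : ℝ) ≤ 2 := by exact_mod_cast hn2
  have hx2 : x ^ 2 ≤ 6 := by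
    rw [hsq, div_le_iff₀ (by linarith)]; linarith
  have hx2' : 3 ≤ x ^ 2 := by
    rw [hsq, le_div_iff₀ (by linarith)]; linarith
  have hx : x ≤ 2.45 := abs_le_of_sq_le_sq' (by linarith) (by norm_num) |>.2
  have hpos : 0 < (1 - y) ^ 2 := by
    have : 1 - y ≠ 0 := fun h => hne (by linarith)
    positivity
  have h2 : 0.2 ≤ 2 * y / (1 - y) ^ 2 := by
    rw [le_div_iff₀ hpos]
    nlinarith
  linarith

/-! ### From `Θ̂` to `R̂`: relative errors and normalisation. -/

section

variable {Ω : Type*} {N : ℕ} {Pm : Matrix (Fin p) (Fin n) ℝ} {Y : Fin n → Ω → (Fin p → ℕ)} {L : ℝ}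

/-- The relative standard deviation of a row mean, up to a constant. -/
noncomputable def relScale (N : ℕ) (L : ℝ) (Pm : Matrix (Fin p) (Fin n) ℝ) (j : Fin p) : ℝ :=
  √(L / (n * N * rowMean Pm j))

/-- The relative error of a row mean. -/
noncomputable def relErr (Pm X : Matrix (Fin p) (Fin n) ℝ) (j : Fin p) : ℝ :=
  (rowMean X j - rowMean Pm j) / rowMean Pm j

theorem relScale_sq (h : StrongSignal N L Pm) (j : Fin p) :
    relScale N L Pm j ^ 2 = L / (n * N * rowMean Pm j) := by
  have := h.rowMean_pos j
  have := h.le_L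
  exact Real.sq_sqrt (by positivity)

/-- The condition on the means gives `L / (n N rowMean) ≤ 3 / (2 n) = κ₁² / 4`. -/
theorem relScale_le_kappa (h : StrongSignal N L Pm) (j : Fin p) :
    relScale N L Pm j ≤ kappa₁ n / 2 := by
  have hL : 0 < L := by linarith [h.le_L]
  have hN : 0 < (N : ℝ) := by linarith [h.le_N]
  have hn : 0 < (n : ℝ) := by exact_mod_cast h.n_pos
  have hj := h.rowMean_pos j
  have h0 := kappa₁_nonneg n
  refine abs_le_of_sq_le_sq' ?_ (by linarith) |>.2
  rw [relScale_sq h, div_pow, kappa₁_sq, div_div, div_le_div_iff₀ (by positivity) (by positivity)]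
  have h1 := h.mean_ge j
  rw [div_le_iff₀ (by positivity)] at h1
  nlinarith

/-- A bound free of `n`: the row sum is at least the row maximum, hence at least `9 L² / N`, so the
square is at most `1 / (9 L) ≤ 2/99`. -/
theorem relScale_le (h : StrongSignal N L Pm) (j : Fin p) : relScale N L Pm j ≤ 0.1422 := by
  have hL : 0 < L := by linarith [h.le_L]
  have hN : 0 < (N : ℝ) := by linarith [h.le_N]
  have hn : 0 < (n : ℝ) := by exact_mod_cast h.n_pos
  have hj := h.rowMean_pos j
  have h1 : (3 * L) ^ 2 / N ≤ n * rowMean Pm j := by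
    refine (h.sup_ge j).trans ?_
    have : n * rowMean Pm j = ∑ i, Pm j i := by rw [rowMean]; field_simp
    rw [this]
    have : Nonempty (Fin n) := ⟨⟨0, h.n_pos⟩⟩
    exact ciSup_le fun i => Finset.single_le_sum (fun i _ => h.prob.1 j i) (Finset.mem_univ i)
  refine abs_le_of_sq_le_sq' ?_ (by norm_num) |>.2
  rw [relScale_sq h, div_le_iff₀ (by positivity)]
  rw [div_le_iff₀ hN] at h1
  have h2 := h.le_L
  nlinarith

theorem GoodEvent.abs_relErr_le {ω : Ω} (hg : GoodEvent N L Pm Y ω) (h : StrongSignal N L Pm)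
    (j : Fin p) : |relErr Pm (freq N Y ω) j|
      ≤ 2 * relScale N L Pm j + 2 / 3 * relScale N L Pm j ^ 2 := by
  have hL : 0 < L := by linarith [h.le_L]
  have hN : 0 < (N : ℝ) := by linarith [h.le_N]
  have hn : 0 < (n : ℝ) := by exact_mod_cast h.n_pos
  have hj := h.rowMean_pos j
  rw [relErr, abs_div, abs_of_pos hj, div_le_iff₀ hj]
  refine (hg.rowMean_close j).trans (le_of_eq ?_)
  have hs0 : 0 ≤ relScale N L Pm j := Real.sqrt_nonneg _
  have hs := relScale_sq h j
  have h1 : L / (n * N) = relScale N L Pm j ^ 2 * rowMean Pm j := by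
    rw [hs]; field_simp
  have h2 : √(4 * rowMean Pm j * (L / (n * N))) = 2 * relScale N L Pm j * rowMean Pm j := by
    rw [Real.sqrt_eq_iff_mul_self_eq (by positivity) (by positivity), h1]; ring
  rw [h2, h1]; ring

/-- One factor of `Θ² / rowMean` is traded for the row maximum by `Theta_le`. This puts the product
of relative errors on the linear scale. -/
theorem Theta_mul_relScale_le (h : StrongSignal N L Pm) (j l : Fin p) :
    Theta Pm j l * relScale N L Pm j
      ≤ √(⨆ i, Pm l i) * √(Theta Pm j l * L / (n * N)) := by
  have hL : 0 < L := by linarith [h.le_L]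
  have hN : 0 < (N : ℝ) := by linarith [h.le_N]
  have hn : 0 < (n : ℝ) := by exact_mod_cast h.n_pos
  have hj := h.rowMean_pos j
  have hΘ := Theta_nonneg h.prob j l
  have hle : Theta Pm j l ≤ (⨆ i, Pm l i) * rowMean Pm j := by
    rw [Theta_comm]; exact Theta_le h.prob l j
  rw [← Real.sqrt_mul (h.rowSup_pos l).le]
  refine Real.le_sqrt_of_sq_le ?_
  rw [mul_pow, relScale_sq h]
  calc Theta Pm j l ^ 2 * (L / (n * N * rowMean Pm j))
      = Theta Pm j l * (Theta Pm j l / rowMean Pm j) * (L / (n * N)) := by field_simp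
    _ ≤ Theta Pm j l * (⨆ i, Pm l i) * (L / (n * N)) := by
        gcongr
        rwa [div_le_iff₀ hj]
    _ = _ := by ring

theorem Theta_mul_add_relScale_le (h : StrongSignal N L Pm) (j l : Fin p) :
    Theta Pm j l * (relScale N L Pm j + relScale N L Pm l) ≤ linScale N L Pm j l := by
  have h1 := Theta_mul_relScale_le h j l
  have h2 := Theta_mul_relScale_le h l j
  rw [Theta_comm Pm l j] at h2
  rw [linScale]
  linarith

theorem ThetaHat_apply (N : ℕ) (X : Matrix (Fin p) (Fin n) ℝ) (j l : Fin p) :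
    ThetaHat N X j l = (n : ℝ)⁻¹ * ∑ i, ((N : ℝ) / ((N : ℝ) - 1) * (X j i * X l i)
      - if j = l then ((N : ℝ) - 1)⁻¹ * X j i else 0) := by
  simp only [ThetaHat, Matrix.smul_apply, Matrix.sum_apply, Matrix.sub_apply,
      Matrix.vecMulVec_apply, Matrix.diagonal_apply, smul_eq_mul, mul_ite, mul_zero]

/-- The error decomposition of the second-order statistic. -/
theorem ThetaHat_eq (h : StrongSignal N L Pm) (ω : Ω) (j l : Fin p) :
    ThetaHat N (freq N Y ω) j l
      = Theta Pm j l * (1 + relErr Pm (freq N Y ω) j + relErr Pm (freq N Y ω) l)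
        + linearPart Pm (freq N Y ω) j l + quadMean N Pm Y ω j l := by
  have hj := (h.rowMean_pos j).ne'
  have hl := (h.rowMean_pos l).ne'
  set X := freq N Y ω with hX
  have h1 : linearPart Pm X j l = (n : ℝ)⁻¹ * ∑ i, (Pm j i * (X l i - Pm l i)
      + Pm l i * (X j i - Pm j i)) - Theta Pm j l / rowMean Pm l * (rowMean X l - rowMean Pm l)
      - Theta Pm j l / rowMean Pm j * (rowMean X j - rowMean Pm j) := by
    have e : ∀ j, rowMean X j - rowMean Pm j = (n : ℝ)⁻¹ * ∑ i, (X j i - Pm j i) := fun j => by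
      rw [rowMean, rowMean, ← mul_sub, Finset.sum_sub_distrib]
    rw [e, e, linearPart]
    rw [mul_left_comm, mul_left_comm (Theta Pm j l / rowMean Pm j), ← mul_sub, ← mul_sub,
      Finset.mul_sum _ _ (Theta Pm j l / rowMean Pm l),
      Finset.mul_sum _ _ (Theta Pm j l / rowMean Pm j), ← Finset.sum_sub_distrib,
      ← Finset.sum_sub_distrib]
    congr 1
    exact Finset.sum_congr rfl fun i _ => by ring
  have h2 : ThetaHat N X j l = quadMean N Pm Y ω j l + Theta Pm j l
      + (n : ℝ)⁻¹ * ∑ i, (Pm j i * (X l i - Pm l i) + Pm l i * (X j i - Pm j i)) := by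
    rw [ThetaHat_apply, quadMean, Theta_apply, ← mul_add, ← mul_add, ← Finset.sum_add_distrib,
      ← Finset.sum_add_distrib]
    congr 1
    refine Finset.sum_congr rfl fun i _ => ?_
    rw [quadRemainder, hX, freq_apply, freq_apply]
    ring
  rw [h2, h1, relErr, relErr]
  field_simp
  ring

theorem RHat_apply {X : Matrix (Fin p) (Fin n) ℝ} (hX : ∀ j i, 0 ≤ X j i) (j l : Fin p) :
    RHat N X j l = ThetaHat N X j l / (rowMean X j * rowMean X l) := by
  simp only [RHat, Matrix.mul_diagonal, Matrix.diagonal_mul]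
  rw [rowNorm_eq_sum (hX j), rowNorm_eq_sum (hX l), rowMean, rowMean, div_eq_mul_inv]
  simp only [mul_inv, inv_inv]
  ring

/-- On the good event the error before normalisation is small. -/
theorem GoodEvent.abs_error_le {ω : Ω} (hg : GoodEvent N L Pm Y ω) (h : StrongSignal N L Pm)
    (j l : Fin p) {q : ℝ} (hq : |quadMean N Pm Y ω j l| ≤ q) :
    |linearPart Pm (freq N Y ω) j l + quadMean N Pm Y ω j l
      - Theta Pm j l * (relErr Pm (freq N Y ω) j * relErr Pm (freq N Y ω) l)|
    ≤ (√6 + 0.32) * linScale N L Pm j l + ((⨆ i, Pm j i) + ⨆ i, Pm l i) * (L / (n * N)) + q := by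
  have hΘ := Theta_nonneg h.prob j l
  have hs0 : ∀ j, 0 ≤ relScale N L Pm j := fun j => Real.sqrt_nonneg _
  -- The bound `relScale ≤ 0.1422` gives `2 + 2/3 * 0.1422 ≤ 2.095`, and in the product `2.095² *
  -- 0.1422 / 2 ≤ 0.32`.
  have hr : ∀ j, |relErr Pm (freq N Y ω) j| ≤ 2.095 * relScale N L Pm j := fun j => by
    have h1 := hg.abs_relErr_le h j
    have h2 := relScale_le h j
    nlinarith [hs0 j]
  have hrr : |relErr Pm (freq N Y ω) j * relErr Pm (freq N Y ω) l|
      ≤ 0.32 * (relScale N L Pm j + relScale N L Pm l) := by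
    rw [abs_mul]
    calc _ ≤ (2.095 * relScale N L Pm j) * (2.095 * relScale N L Pm l) :=
          mul_le_mul (hr j) (hr l) (abs_nonneg _) (by have := hs0 j; positivity)
      _ ≤ _ := by
          have h1 := mul_le_mul_of_nonneg_left (relScale_le h l) (hs0 j)
          have h2 := mul_le_mul_of_nonneg_right (relScale_le h j) (hs0 l)
          nlinarith [hs0 j, hs0 l]
  have h3 : |Theta Pm j l * (relErr Pm (freq N Y ω) j * relErr Pm (freq N Y ω) l)|
      ≤ 0.32 * linScale N L Pm j l := by
    rw [abs_mul, abs_of_nonneg hΘ]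
    have := mul_le_mul_of_nonneg_left hrr hΘ
    linarith [Theta_mul_add_relScale_le h j l]
  have h4 := hg.linear_le j l
  refine (abs_sub _ _).trans ((add_le_add (abs_add_le _ _) le_rfl).trans ?_)
  linarith

theorem eta_eq (hp : 0 < p) (Pm : Matrix (Fin p) (Fin n) ℝ) (j l : Fin p) :
    eta N Pm j l = 3 * √6 * linScale N (Real.log (bigM n p N)) Pm j l
      + 2 * (((⨆ i, Pm j i) + ⨆ i, Pm l i) * (Real.log (bigM n p N) / (n * N)))
      + 31 * (1 + kappa₁ n) * quadScale N (Real.log (bigM n p N)) Pm j l + kappa₂ n p N := by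
  have hp' : (p : ℝ) ≠ 0 := by positivity
  have h1 : ∀ j, mMax Pm j / p = ⨆ i, Pm j i := fun j => by rw [mMax]; field_simp
  have h2 : ∀ j, mu Pm j = p * rowMean Pm j := fun j => by rw [mu, rowMean]; ring
  have h3 : (mu Pm j + mu Pm l) / p = rowMean Pm j + rowMean Pm l := by
    rw [h2, h2]; field_simp
  have h4 : 2 * (mMax Pm j + mMax Pm l) / p = 2 * ((⨆ i, Pm j i) + ⨆ i, Pm l i) := by
    rw [mul_div_assoc, add_div, h1, h1]
  rw [eta, h1, h1, h3, h4, linScale, quadScale]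
  ring

/-- The first summand of `deltaEntry` is already this quantity, and the second is non-negative. -/
theorem eta_div_le_deltaEntry (hp : 0 < p) (h : StrongSignal N L Pm) (j l : Fin p) :
    (1 + kappa₁ n * kappa₃ n) * eta N Pm j l / (rowMean Pm j * rowMean Pm l)
      ≤ deltaEntry N Pm j l := by
  have hp' : (p : ℝ) ≠ 0 := by positivity
  have h2 : ∀ j, mu Pm j = p * rowMean Pm j := fun j => by rw [mu, rowMean]; ring
  have hj := h.rowMean_pos j
  have hl := h.rowMean_pos l
  have h3 : (p : ℝ) ^ 2 / (mu Pm j * mu Pm l) = (rowMean Pm j * rowMean Pm l)⁻¹ := by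
    rw [h2, h2]; field_simp
  have h4 : 0 ≤ kappa₃ n * ((p : ℝ) ^ 2 * Theta Pm j l / (mu Pm j * mu Pm l))
      * (√(p / mu Pm j) + √(p / mu Pm l)) * √(Real.log (bigM n p N) / (n * N)) := by
    have := Theta_nonneg h.prob j l
    have := kappa₃_nonneg n
    rw [h2, h2]
    positivity
  rw [deltaEntry, h3]
  have : (1 + kappa₁ n * kappa₃ n) * eta N Pm j l / (rowMean Pm j * rowMean Pm l)
      = (1 + kappa₁ n * kappa₃ n) * (rowMean Pm j * rowMean Pm l)⁻¹ * eta N Pm j l := by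
    rw [div_eq_mul_inv]; ring
  linarith

/-- On the good event `R̂` is entrywise within the tolerances of its population version. -/
theorem GoodEvent.abs_RHat_sub_le {ω : Ω} (hg : GoodEvent N L Pm Y ω) (h : StrongSignal N L Pm)
    (hp : 0 < p) (hL : L = Real.log (bigM n p N)) (j l : Fin p) :
    |RHat N (freq N Y ω) j l - Theta Pm j l / (rowMean Pm j * rowMean Pm l)|
      ≤ deltaEntry N Pm j l := by
  have hj := h.rowMean_pos j
  have hl := h.rowMean_pos l
  set X := freq N Y ω with hX
  -- The two bounds on `relScale`, inserted into `2 s + 2/3 s²`, give `κ₁ + κ₁² / 6` and `0.298`.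
  set z := min (kappa₁ n + kappa₁ n ^ 2 / 6) 0.298 with hz
  have hk0 := kappa₁_nonneg n
  have hzk : z ≤ kappa₁ n + kappa₁ n ^ 2 / 6 := min_le_left _ _
  have hz1 : z ≤ 0.298 := min_le_right _ _
  have hr : ∀ j, |relErr Pm X j| ≤ z := fun j => by
    have h1 := hg.abs_relErr_le h j
    have h2 := relScale_le h j
    have h3 := relScale_le_kappa h j
    have h0 : 0 ≤ relScale N L Pm j := Real.sqrt_nonneg _
    refine h1.trans (le_min ?_ ?_) <;> nlinarith
  have hw : ∀ j, 1 - z ≤ 1 + relErr Pm X j := fun j => by linarith [(abs_le.1 (hr j)).1]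
  have hmean : ∀ j, rowMean X j = rowMean Pm j * (1 + relErr Pm X j) := fun j => by
    have := (h.rowMean_pos j).ne'
    rw [relErr]; field_simp; ring
  have hzpos : 0 < 1 - z := by linarith
  have hwj : 0 < 1 + relErr Pm X j := hzpos.trans_le (hw j)
  have hwl : 0 < 1 + relErr Pm X l := hzpos.trans_le (hw l)
  set D := linearPart Pm X j l + quadMean N Pm Y ω j l
      - Theta Pm j l * (relErr Pm X j * relErr Pm X l) with hD
  -- Since `1 + r_j + r_l = (1 + r_j)(1 + r_l) - r_j r_l`, dividing by the empirical means
  -- reproduces the population entry exactly, up to `D`.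
  have hform : RHat N X j l - Theta Pm j l / (rowMean Pm j * rowMean Pm l)
      = D / ((1 + relErr Pm X j) * (1 + relErr Pm X l)) / (rowMean Pm j * rowMean Pm l) := by
    rw [RHat_apply (fun j i => by rw [hX, freq_apply]; positivity), hmean, hmean,
      ThetaHat_eq h ω j l, hD]
    field_simp
    ring
  have hU : 0 ≤ linScale N L Pm j l := by unfold linScale; positivity
  have hV : 0 ≤ quadScale N L Pm j l := Real.sqrt_nonneg _
  have hm : 0 ≤ ((⨆ i, Pm j i) + ⨆ i, Pm l i) * (L / (n * N)) := by
    have := h.rowSup_pos j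
    have := h.rowSup_pos l
    have := h.le_L
    positivity
  -- The term `κ₂` and the `κ₁` share of the third term of `η` are not needed.
  have hη : 3 * √6 * linScale N L Pm j l + 2 * (((⨆ i, Pm j i) + ⨆ i, Pm l i) * (L / (n * N)))
      + 31 * quadScale N L Pm j l ≤ eta N Pm j l := by
    rw [eta_eq hp, ← hL]
    have h1 : 0 ≤ kappa₂ n p N := by unfold kappa₂; positivity
    nlinarith [mul_nonneg hk0 hV]
  have h6 : 2.449 ≤ √6 := Real.le_sqrt_of_sq_le (by norm_num)
  have h6U := mul_le_mul_of_nonneg_right h6 hU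
  have hkk : 0 ≤ kappa₁ n * kappa₃ n := mul_nonneg hk0 (kappa₃_nonneg n)
  have hDle : |D| / ((1 + relErr Pm X j) * (1 + relErr Pm X l)) ≤ |D| * ((1 - z) ^ 2)⁻¹ := by
    rw [div_eq_mul_inv]
    have : (1 - z) ^ 2 ≤ (1 + relErr Pm X j) * (1 + relErr Pm X l) := by
      rw [sq]; exact mul_le_mul (hw j) (hw l) hzpos.le hwj.le
    gcongr
  have hmain : |D| * ((1 - z) ^ 2)⁻¹ ≤ (1 + kappa₁ n * kappa₃ n) * eta N Pm j l := by
    -- Coefficients of the linear scale, against `3 √6`: for `n ≤ 2`, `1.71 * (√6 + 0.32 + 1.1)`,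
    -- where `1.71` comes from `2.05 / 1.2`; for `n ≥ 3`, `√6 + 0.32 + 4.06`. On the quadratic
    -- scale, `1.71 * 7` and `28.9` stay below `31`.
    rcases Nat.lt_or_ge n 3 with hn | hn
    · have h1 := hg.abs_error_le h j l (hg.abs_quadMean_le_of_le_two h (by omega) j l)
      have h2 := le_one_add_kappa h.n_pos (by omega)
      have h3 : ((1 - z) ^ 2)⁻¹ ≤ 1.71 * (1 + kappa₁ n * kappa₃ n) :=
        (inv_sq_one_sub_le hz1).trans (by linarith)
      calc |D| * ((1 - z) ^ 2)⁻¹ ≤ |D| * (1.71 * (1 + kappa₁ n * kappa₃ n)) := by gcongr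
        _ = (1 + kappa₁ n * kappa₃ n) * (1.71 * |D|) := by ring
        _ ≤ _ := by
            gcongr
            linarith
    · have h1 := hg.abs_error_le h j l (hg.abs_quadMean_le h j l)
      calc |D| * ((1 - z) ^ 2)⁻¹ ≤ |D| * (1 + kappa₁ n * kappa₃ n) := by
            gcongr; exact inv_sq_le_one_add_kappa hn hzk hz1
        _ = (1 + kappa₁ n * kappa₃ n) * |D| := by ring
        _ ≤ _ := by
            gcongr
            linarith
  rw [hform, abs_div, abs_div, abs_of_pos (mul_pos hj hl), abs_of_pos (mul_pos hwj hwl)]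
  refine le_trans ?_ (eta_div_le_deltaEntry hp h j l)
  gcongr
  exact hDle.trans hmain

end

/-! ### Numerical consequences of the signal conditions. -/

theorem mul_le_mul_log_of_two_pow_le {k m : ℕ} {c M : ℝ} (hc : 0 ≤ c) (hcM : c ≤ M)
    (h : (2 : ℝ) ^ k ≤ c ^ m) : k * 0.6931 ≤ m * Real.log M := by
  have h1 : (2 : ℝ) ^ k ≤ M ^ m := h.trans (pow_le_pow_left₀ hc hcM m)
  have h2 := Real.log_le_log (by positivity) h1
  rw [Real.log_pow, Real.log_pow] at h2
  have h3 : (0.6931 : ℝ) ≤ Real.log 2 := by linarith [Real.log_two_gt_d9]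
  have h4 : (k : ℝ) * 0.6931 ≤ k * Real.log 2 := mul_le_mul_of_nonneg_left h3 (Nat.cast_nonneg _)
  linarith

/-- A number that dominates `9 (log M)²` for some `M` above it is not small. -/
theorem le_log_of_nine_mul_log_sq_le {N M : ℝ} (hN : 2 ≤ N) (hNM : N ≤ M)
    (h : (3 * Real.log M) ^ 2 ≤ N) : 11 / 2 ≤ Real.log M ∧ 200 ≤ N := by
  have step : ∀ (k m : ℕ) (c : ℝ), 0 ≤ c → c ≤ N → (2 : ℝ) ^ k ≤ c ^ m →
      k * 0.6931 ≤ m * Real.log M := fun k m c hc hcN hk =>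
    mul_le_mul_log_of_two_pow_le hc (hcN.trans hNM) hk
  set l := Real.log M
  -- Bootstrap: a lower bound on `N` bounds `log M` from below, and `N ≥ 9 (log M)²` then improves
  -- the bound on `N`, up to `N ≥ 256` and `log M ≥ 8 * 0.6931`.
  have s1 := step 1 1 2 (by norm_num) hN (by norm_num)
  have n1 : 4 ≤ N := by norm_num at s1; nlinarith
  have s2 := step 2 1 4 (by norm_num) n1 (by norm_num)
  have n2 : 16 ≤ N := by norm_num at s2; nlinarith
  have s3 := step 4 1 16 (by norm_num) n2 (by norm_num)
  have n3 : 64 ≤ N := by norm_num at s3; nlinarith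
  have s4 := step 6 1 64 (by norm_num) n3 (by norm_num)
  have n4 : 128 ≤ N := by norm_num at s4; nlinarith
  have s5 := step 7 1 128 (by norm_num) n4 (by norm_num)
  have n5 : 211 ≤ N := by norm_num at s5; nlinarith
  have s6 := step 15 2 211 (by norm_num) n5 (by norm_num)
  have n6 : 243 ≤ N := by norm_num at s6; nlinarith
  have s7 := step 31 4 243 (by norm_num) n6 (by norm_num)
  have n7 : 256 ≤ N := by norm_num at s7; nlinarith
  have s8 := step 8 1 256 (by norm_num) n7 (by norm_num)
  norm_num at s8
  constructor <;> linarith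

/-- Entries of `Π` are at most `1`, so the condition on the maxima gives `9 L² ≤ N` and starts the
bootstrap. Summing the condition on the means over all words gives `2 p L ≤ 3 N`, whence `p < N ≤
M`, strictly. -/
theorem StrongSignal.of_assumptions {N : ℕ} {Pm : Matrix (Fin p) (Fin n) ℝ}
    (hn : 0 < n) (hp : 0 < p) (hN : 2 ≤ N) (hPm : ColumnsAreProbabilities Pm)
    (hmean : ∀ j, 2 * Real.log (bigM n p N) / (3 * N) ≤ (n : ℝ)⁻¹ * ∑ i, Pm j i)
    (hsup : ∀ j, (3 * Real.log (bigM n p N)) ^ 2 / N ≤ ⨆ i, Pm j i) :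
    StrongSignal N (Real.log (bigM n p N)) Pm := by
  have hN2 : (2 : ℝ) ≤ N := by exact_mod_cast hN
  have hNM : (N : ℝ) ≤ bigM n p N := by exact_mod_cast le_max_right _ _
  have hnM : (n : ℝ) ≤ bigM n p N := by exact_mod_cast (le_max_left n p).trans (le_max_left _ _)
  have hn' : 0 < (n : ℝ) := by exact_mod_cast hn
  have : Nonempty (Fin n) := ⟨⟨0, hn⟩⟩
  have h9 : (3 * Real.log (bigM n p N)) ^ 2 ≤ N := by
    have h1 := (hsup ⟨0, hp⟩).trans (ciSup_le fun i => hPm.le_one ⟨0, hp⟩ i)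
    rwa [div_le_one (by linarith)] at h1
  obtain ⟨hL, hN200⟩ := le_log_of_nine_mul_log_sq_le hN2 hNM h9
  have hexp : Real.exp (Real.log (bigM n p N)) = bigM n p N := Real.exp_log (by linarith)
  refine ⟨hPm, hn, hL, hN200, by rwa [hexp], by rwa [hexp], ?_, hmean, hsup⟩
  rw [hexp]
  refine lt_of_lt_of_le ?_ hNM
  set L := Real.log (bigM n p N)
  have h1 : ∑ j, (n : ℝ)⁻¹ * ∑ i, Pm j i = 1 := by
    have : ∑ j, ∑ i, Pm j i = n :=
      (Finset.sum_comm (f := fun j i => Pm j i)).trans (by simp [hPm.2])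
    rw [← Finset.mul_sum, this, inv_mul_cancel₀ hn'.ne']
  have h2 : p * (2 * L / (3 * N)) ≤ 1 := by
    rw [← h1]
    refine le_trans (le_of_eq ?_) (Finset.sum_le_sum fun j _ => hmean j)
    simp
  rw [← mul_div_assoc, div_le_one (by linarith)] at h2
  have hp' : (0 : ℝ) < p := by exact_mod_cast hp
  nlinarith

end TopicModel

/-! ### Combining the two halves. -/

open TopicModel
theorem mainTheorem7 {Ω : Type*} [MeasurableSpace Ω] (P : Measure Ω) [IsProbabilityMeasure P]
    (p n K N : ℕ) (hn : 1 ≤ n) (hN : 2 ≤ N)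
    (A : Matrix (Fin p) (Fin K) ℝ) (W : Matrix (Fin K) (Fin n) ℝ)
    (hA : ColumnsAreProbabilities A) (hW : ColumnsAreProbabilities W)
    (Y : Fin n → Ω → (Fin p → ℕ)) (hY : IsMultinomialSample P N (A * W) Y)
    (hsep : ∀ k : Fin K, ∃ j : Fin p, 0 < A j k ∧ ∀ l, l ≠ k → A j l = 0)
    (hnu : ((4 * delta N (A * W) : ℝ) : EReal) < nu W)
    (hsignal_avg : ∀ j : Fin p,
      2 * Real.log (bigM n p N) / (3 * N) ≤ (n : ℝ)⁻¹ * ∑ i, (A * W) j i)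
    (hsignal_max : ∀ j : Fin p,
      (3 * Real.log (bigM n p N)) ^ 2 / N ≤ ⨆ i, (A * W) j i)
    (hJ1 : quasiAnchor N A W = ∅) :
    1 - 8 * ((bigM n p N : ℕ) : ℝ)⁻¹ <
      P.real {ω | ∀ a : Fin p → Fin p, IsArgmax (RHat N (freq N Y ω)) a →
        ExactRecovery A
          (findAnchorWords (RHat N (freq N Y ω)) (Matrix.of (deltaEntry N (A * W))) a)} := by
  have hPm := hA.mul hW
  have hp : 0 < p := by
    rcases Nat.eq_zero_or_pos p with rfl | h
    · have := hPm.2 ⟨0, hn⟩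
      simp at this
    · exact h
  have hS := StrongSignal.of_assumptions hn hp hN hPm hsignal_avg hsignal_max
  have hbad := measureReal_not_goodEvent_lt hp hS hY
  have hM : (0 : ℝ) < (bigM n p N : ℕ) := by
    have : N ≤ bigM n p N := le_max_right _ _
    exact_mod_cast (by omega : 0 < bigM n p N)
  rw [Real.exp_neg, Real.exp_log hM] at hbad
  have hpos : ∀ j, 0 < ∑ i, (A * W) j i := fun j =>
    pos_of_mul_pos_right (hS.rowMean_pos j) (inv_nonneg.2 (Nat.cast_nonneg n))
  set S := {ω | ∀ a : Fin p → Fin p, IsArgmax (RHat N (freq N Y ω)) a →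
        ExactRecovery A
          (findAnchorWords (RHat N (freq N Y ω)) (Matrix.of (deltaEntry N (A * W))) a)} with hSdef
  set B := {ω | ¬ GoodEvent N (Real.log (bigM n p N)) (A * W) Y ω} with hB
  -- Covering the whole space by the success event and the bad event uses only subadditivity, so
  -- neither event has to be shown measurable.
  have hcover : (Set.univ : Set Ω) ⊆ S ∪ B := by
    intro ω _
    by_cases hg : GoodEvent N (Real.log (bigM n p N)) (A * W) Y ω
    · exact Or.inl fun a ha => exactRecovery_of_RHat_close hA hW hn hp hsep hpos hnu hJ1
        (fun j l => hg.abs_RHat_sub_le hS hp rfl j l) ha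
    · exact Or.inr hg
  have h1 : (1 : ℝ) ≤ P.real S + P.real B := by
    rw [← probReal_univ (μ := P)]
    exact (measureReal_mono hcover).trans (measureReal_union_le _ _)
  linarith
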